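/- Let $X$ be a Kähler manifold of complex dimension $3$ (not assumed compact) with complex structure $J$, Riemannian metric $g$ and Kähler form $\omega(u,v)=g(Ju,v)$. Let $L\to X$ be a smooth complex line bundle with a smooth Hermitian metric $h$, let $\nabla$ be a smooth Hermitian connection on $(L,h)$, i.e. one with $d\,h(s,t)=h(\nabla s,t)+h(s,\nabla t)$, and let $F_\nabla$ be its curvature, regarded as an $\sqrt{-1}\,\mathbb R$-valued $2$-form on $X$. Conventions. Norms of forms are pointwise and are induced by $g$, such that for an orthonormal coframe $(e^i)$ the forms $e^{i_1}\wedge\dots\wedge e^{i_k}$ with $i_1<\dots<i_k$ are orthonormal; for complex-valued forms the Hermitian extension is used. For $p\neq q$ put $[\![\Lambda^{p,q}]\!]=(\Lambda^{p,q}\oplus\Lambda^{q,p})\cap\Lambda^{p+q}T^*X$ (the real forms in $\Lambda^{p,q}\oplus\Lambda^{q,p}$), and let $\pi^{[\![p,q]\!]}:\Lambda^{p+q}T^*X\to[\![\Lambda^{p,q}]\!]$ be the orthogonal projection, extended complex-linearly to complex-valued forms. The endomorphism $(-\sqrt{-1}F_\nabla)^\sharp$ of $TX$ is defined by $g\big((-\sqrt{-1}F_\nabla)^\sharp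 u,v\big)=-\sqrt{-1}F_\nabla(u,v)$. For $\theta\in\mathbb R$, $\nabla$ is called a deformed Hermitian Yang–Mills (dHYM) connection with phase $e^{\sqrt{-1}\theta}$ if $\pi^{[\![2,0]\!]}(-\sqrt{-1}F_\nabla)=0$ and $\operatorname{Im}\big(e^{-\sqrt{-1}\theta}(\omega+F_\nabla)^3\big)=0$ on $X$. **Theorem.** At every point of $X$, $$\left|\frac{(\omega+F_\nabla)^3}{3!}\right|^2+2\left|\pi^{[\![3,1]\!]}\left(\frac{(\omega+F_\nabla)^2}{2!}\right)\right|^2=\det\big(\mathrm{id}_{TX}+(-\sqrt{-1}F_\nabla)^\sharp\big).$$ In particular, for every $\theta\in\mathbb R$, at every point of $X$, $$\left|\operatorname{Re}\left(e^{-\sqrt{-1}\theta}\,\frac{(\omega+F_\nabla)^3}{3!}\right)\right|\le\sqrt{\det\big(\mathrm{id}_{TX}+(-\sqrt{-1}F_\nabla)^\sharp\big)},$$ and equality holds at every point of $X$ if and only if $\nabla$ is a dHYM connection with phase $e^{\sqrt{-1}\theta}$. -/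

import Mathlib

open Bundle Module
open scoped Manifold ContDiff

noncomputable section

namespace MirrorSL

/-! ### Exterior algebra of a Euclidean vector space with a complex structure -/

section Algebraic

variable {V W : Type*} [AddCommGroup V] [Module ℝ V] [AddCommGroup W] [Module ℝ W] {k p q : ℕ}

/-- The 2-form given by an alternating bilinear map. -/
def twoFormOfBilin (B : V →ₗ[ℝ] V →ₗ[ℝ] W) (hB : ∀ v, B v v = 0) : V [⋀^Fin 2]→ₗ[ℝ] W where
  toFun v := B (v 0) (v 1)
  map_update_add' v i x y := by
    fin_cases i <;> simp
  map_update_smul' v i c x := by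
    fin_cases i <;> simp
  map_eq_zero_of_eq' v i j h hij := by
    fin_cases i <;> fin_cases j <;> simp_all

/-- The bilinear map given by a 2-form. -/
def bilinOfTwoForm (α : V [⋀^Fin 2]→ₗ[ℝ] W) : V →ₗ[ℝ] V →ₗ[ℝ] W :=
  have e₀ (u v x : V) : Function.update ![u, v] 0 x = ![x, v] := by
    funext i; fin_cases i <;> rfl
  have e₁ (u v x : V) : Function.update ![u, v] 1 x = ![u, x] := by
    funext i; fin_cases i <;> rfl
  LinearMap.mk₂ ℝ (fun u v => α ![u, v])
    (fun u u' v => by simpa only [e₀] using α.map_update_add ![u, v] 0 u u')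
    (fun c u v => by simpa only [e₀] using α.map_update_smul ![u, v] 0 c u)
    (fun u v v' => by simpa only [e₁] using α.map_update_add ![u, v] 1 v v')
    (fun c u v => by simpa only [e₁] using α.map_update_smul ![u, v] 1 c v)

/-- The exterior product of complex-valued forms (sum over shuffles, without numerical factor). -/
def wedge (α : V [⋀^Fin p]→ₗ[ℝ] ℂ) (β : V [⋀^Fin q]→ₗ[ℝ] ℂ) : V [⋀^Fin (p + q)]→ₗ[ℝ] ℂ :=
  ((LinearMap.mul' ℝ ℂ).compAlternatingMap (α.domCoprod β)).domDomCongr finSumFinEquiv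

/-- The square `α ∧ α` of a 2-form. -/
def wedgeSq (α : V [⋀^Fin 2]→ₗ[ℝ] ℂ) : V [⋀^Fin 4]→ₗ[ℝ] ℂ := wedge α α

/-- The cube `α ∧ α ∧ α` of a 2-form. -/
def wedgeCube (α : V [⋀^Fin 2]→ₗ[ℝ] ℂ) : V [⋀^Fin 6]→ₗ[ℝ] ℂ := wedge (wedgeSq α) α

/-- A real form viewed as a complex-valued form. -/
def ofRealForm (α : V [⋀^Fin k]→ₗ[ℝ] ℝ) : V [⋀^Fin k]→ₗ[ℝ] ℂ :=
  Complex.ofRealCLM.toLinearMap.compAlternatingMap α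

/-- The real part of a complex-valued form. -/
def reForm (α : V [⋀^Fin k]→ₗ[ℝ] ℂ) : V [⋀^Fin k]→ₗ[ℝ] ℝ :=
  Complex.reLm.compAlternatingMap α

/-- The imaginary part of a complex-valued form. -/
def imForm (α : V [⋀^Fin k]→ₗ[ℝ] ℂ) : V [⋀^Fin k]→ₗ[ℝ] ℝ :=
  Complex.imLm.compAlternatingMap α

/-- The exterior product `a 0 ∧ ⋯ ∧ a (k - 1)` of complex-valued 1-forms. -/
def wedgeOneForms (a : Fin k → V →ₗ[ℝ] ℂ) : V [⋀^Fin k]→ₗ[ℝ] ℂ :=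
  MultilinearMap.alternatization ((MultilinearMap.mkPiAlgebra ℝ (Fin k) ℂ).compLinearMap a)

theorem wedgeOneForms_apply (a : Fin k → V →ₗ[ℝ] ℂ) (v : Fin k → V) :
    wedgeOneForms a v = Matrix.det (Matrix.of fun i j => a j (v i)) := by
  simp [wedgeOneForms, MultilinearMap.alternatization_apply, Matrix.det_apply]

/-- The space `Λ^{p, k - p}` of complex-valued `k`-forms of type `(p, k - p)`, for `p ≤ k`: the
complex span of the exterior products of `p` complex-linear (type `(1, 0)`) and `k - p`
antilinear (type `(0, 1)`) 1-forms. -/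
def formsOfType (J : V →ₗ[ℝ] V) (k p : ℕ) : Submodule ℂ (V [⋀^Fin k]→ₗ[ℝ] ℂ) :=
  Submodule.span ℂ {α | ∃ a : Fin k → V →ₗ[ℝ] ℂ,
    (∀ i : Fin k, (i : ℕ) < p → ∀ v, a i (J v) = Complex.I * a i v) ∧
    (∀ i : Fin k, p ≤ (i : ℕ) → ∀ v, a i (J v) = -Complex.I * a i v) ∧
    α = wedgeOneForms a}

/-- The real vector space `⟦Λ^{p, q}⟧ = (Λ^{p, q} ⊕ Λ^{q, p}) ∩ Λ^{p + q} V^*`, for `p ≠ q`. -/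
def realFormsOfType (J : V →ₗ[ℝ] V) (p q : ℕ) : Submodule ℝ (V [⋀^Fin (p + q)]→ₗ[ℝ] ℝ) where
  carrier := {α | ofRealForm α ∈ formsOfType J (p + q) p ⊔ formsOfType J (p + q) q}
  zero_mem' := by
    have : ofRealForm (0 : V [⋀^Fin (p + q)]→ₗ[ℝ] ℝ) = 0 := by ext; simp [ofRealForm]
    simp [this]
  add_mem' {α β} hα hβ := by
    have : ofRealForm (α + β) = ofRealForm α + ofRealForm β := by ext; simp [ofRealForm]
    simpa [this] using add_mem hα hβ
  smul_mem' r α hα := by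
    have : ofRealForm (r • α) = (r : ℂ) • ofRealForm α := by ext; simp [ofRealForm]
    rw [Set.mem_ofPred_eq, this]
    exact Submodule.smul_mem _ (r : ℂ) hα

end Algebraic

section Linear

variable {V : Type*} [NormedAddCommGroup V] [InnerProductSpace ℝ V] {k : ℕ}

/-- The fundamental form `(u, v) ↦ ⟪J u, v⟫` of an orthogonal complex structure `J`. -/
def fundamentalForm (J : V →ₗ[ℝ] V) (hJ : ∀ v, J (J v) = -v)
    (hg : ∀ u v, inner ℝ (J u) (J v) = inner ℝ u v) : V [⋀^Fin 2]→ₗ[ℝ] ℝ :=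
  twoFormOfBilin ((innerₗ V).comp J) fun v => by
    have h := hg (J v) v
    rw [hJ, inner_neg_left, real_inner_comm (J v) v] at h
    simp only [LinearMap.comp_apply, innerₗ_apply_apply]
    linarith

theorem fundamentalForm_apply (J : V →ₗ[ℝ] V) (hJ : ∀ v, J (J v) = -v)
    (hg : ∀ u v, inner ℝ (J u) (J v) = inner ℝ u v) (u v : V) :
    fundamentalForm J hJ hg ![u, v] = inner ℝ (J u) v := rfl

variable [FiniteDimensional ℝ V]

/-- The pointwise norm of a form with real or complex values. In an orthonormal basis `e` it is
`|α|² = ∑_{i₁ < ⋯ < iₖ} |α(e_{i₁}, …, e_{iₖ})|² = (1 / k!) ∑_{i₁, …, iₖ} |α(e_{i₁}, …, e_{iₖ})|²`,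
so that the forms `e^{i₁} ∧ ⋯ ∧ e^{iₖ}` with `i₁ < ⋯ < iₖ` have norm one. -/
def formNorm {W : Type*} [NormedAddCommGroup W] [NormedSpace ℝ W] (α : V [⋀^Fin k]→ₗ[ℝ] W) : ℝ :=
  √((k.factorial : ℝ)⁻¹ *
    ∑ i : Fin k → Fin (finrank ℝ V), ‖α (fun j => stdOrthonormalBasis ℝ V (i j))‖ ^ 2)

/-- The inner product of real forms that induces `formNorm`. -/
def formInner (α β : V [⋀^Fin k]→ₗ[ℝ] ℝ) : ℝ :=
  (k.factorial : ℝ)⁻¹ * ∑ i : Fin k → Fin (finrank ℝ V),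
    α (fun j => stdOrthonormalBasis ℝ V (i j)) * β (fun j => stdOrthonormalBasis ℝ V (i j))

theorem form_eq_zero {α : V [⋀^Fin k]→ₗ[ℝ] ℝ}
    (h : ∀ i : Fin k → Fin (finrank ℝ V), α (fun j => stdOrthonormalBasis ℝ V (i j)) = 0) :
    α = 0 := by
  refine Basis.ext_alternating (stdOrthonormalBasis ℝ V).toBasis ?_
  intro v _
  simpa using h v

variable (V k) in
/-- `formInner` is an inner product. -/
@[reducible] def formCore : InnerProductSpace.Core ℝ (V [⋀^Fin k]→ₗ[ℝ] ℝ) where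
  inner := formInner
  conj_inner_symm α β := by simp [formInner, mul_comm]
  re_inner_nonneg α := by
    simp only [formInner, RCLike.re_to_real]
    exact mul_nonneg (by positivity) (Finset.sum_nonneg fun i _ => mul_self_nonneg _)
  add_left α β γ := by simp [formInner, add_mul, Finset.sum_add_distrib, mul_add]
  smul_left α β r := by
    simp only [formInner, AlternatingMap.smul_apply, smul_eq_mul, conj_trivial, Finset.mul_sum]
    exact Finset.sum_congr rfl fun i _ => by ring
  definite α h := by
    have hk : ((k.factorial : ℝ)⁻¹) ≠ 0 := by positivity
    have h' := (mul_eq_zero.1 (show formInner α α = 0 from h)).resolve_left hk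
    rw [Finset.sum_eq_zero_iff_of_nonneg fun i _ => mul_self_nonneg _] at h'
    exact form_eq_zero fun i => mul_self_eq_zero.1 (h' i (Finset.mem_univ i))

instance finiteDimensional_form : FiniteDimensional ℝ (V [⋀^Fin k]→ₗ[ℝ] ℝ) := by
  let ev : (V [⋀^Fin k]→ₗ[ℝ] ℝ) →ₗ[ℝ] ((Fin k → Fin (finrank ℝ V)) → ℝ) :=
    { toFun := fun α i => α (fun j => stdOrthonormalBasis ℝ V (i j))
      map_add' := fun _ _ => rfl
      map_smul' := fun _ _ => rfl }
  refine FiniteDimensional.of_injective ev ((injective_iff_map_eq_zero ev).2 fun α h => ?_)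
  exact form_eq_zero fun i => congrFun h i

/-- The orthogonal projection of real `k`-forms onto a subspace `S`, with respect to the inner
product `formInner`. -/
def orthProj (S : Submodule ℝ (V [⋀^Fin k]→ₗ[ℝ] ℝ)) :
    (V [⋀^Fin k]→ₗ[ℝ] ℝ) →ₗ[ℝ] (V [⋀^Fin k]→ₗ[ℝ] ℝ) :=
  letI : NormedAddCommGroup (V [⋀^Fin k]→ₗ[ℝ] ℝ) := (formCore V k).toNormedAddCommGroup
  letI : InnerProductSpace ℝ (V [⋀^Fin k]→ₗ[ℝ] ℝ) := InnerProductSpace.ofCore (formCore V k).toCore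
  haveI : S.HasOrthogonalProjection := inferInstance
  S.starProjection.toLinearMap

/-- The defining property of the orthogonal projection. -/
theorem orthProj_spec (S : Submodule ℝ (V [⋀^Fin k]→ₗ[ℝ] ℝ)) (α : V [⋀^Fin k]→ₗ[ℝ] ℝ) :
    orthProj S α ∈ S ∧ ∀ β ∈ S, formInner (α - orthProj S α) β = 0 := by
  let _ : NormedAddCommGroup (V [⋀^Fin k]→ₗ[ℝ] ℝ) := (formCore V k).toNormedAddCommGroup
  let _ : InnerProductSpace ℝ (V [⋀^Fin k]→ₗ[ℝ] ℝ) := InnerProductSpace.ofCore (formCore V k).toCore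
  have : S.HasOrthogonalProjection := inferInstance
  refine ⟨S.starProjection_apply_mem α, fun β hβ => ?_⟩
  exact S.starProjection_inner_eq_zero α β hβ

/-- The orthogonal projection `π^{⟦p, q⟧} : Λ^{p + q} V^* → ⟦Λ^{p, q}⟧`. -/
def typeProj (J : V →ₗ[ℝ] V) (p q : ℕ) :
    (V [⋀^Fin (p + q)]→ₗ[ℝ] ℝ) →ₗ[ℝ] (V [⋀^Fin (p + q)]→ₗ[ℝ] ℝ) :=
  orthProj (realFormsOfType J p q)

/-- The complex-linear extension of `π^{⟦p, q⟧}` to complex-valued forms. -/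
def typeProjC (J : V →ₗ[ℝ] V) (p q : ℕ) (α : V [⋀^Fin (p + q)]→ₗ[ℝ] ℂ) :
    V [⋀^Fin (p + q)]→ₗ[ℝ] ℂ :=
  ofRealForm (typeProj J p q (reForm α)) + Complex.I • ofRealForm (typeProj J p q (imForm α))

/-- The endomorphism `α^♯` of a real 2-form `α`, given by `u ↦ (i(u) α)^♯`, that is
`⟪α^♯ u, v⟫ = α(u, v)`. -/
def sharp (α : V [⋀^Fin 2]→ₗ[ℝ] ℝ) : V →ₗ[ℝ] V where
  toFun u := (InnerProductSpace.toDual ℝ V).symm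
    (LinearMap.toContinuousLinearMap (bilinOfTwoForm α u))
  map_add' u v := by simp
  map_smul' r u := by simp

theorem inner_sharp (α : V [⋀^Fin 2]→ₗ[ℝ] ℝ) (u v : V) : inner ℝ (sharp α u) v = α ![u, v] := by
  simp [sharp, bilinOfTwoForm]

end Linear

/-! ### Kähler manifolds -/

section Kaehler

variable {E : Type*} [NormedAddCommGroup E] [NormedSpace ℂ E]
  {X : Type*} [TopologicalSpace X] [ChartedSpace E X]

/-- A complex manifold is a smooth real manifold. -/
instance isManifold_real [h : IsManifold 𝓘(ℂ, E) ω X] : IsManifold 𝓘(ℝ, E) ∞ X := by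
  refine isManifold_of_contDiffOn _ _ _ fun e e' he he' => ?_
  have h1 := (contDiffGroupoid ω 𝓘(ℂ, E)).compatible he he'
  rw [contDiffGroupoid, mem_groupoid_of_pregroupoid] at h1
  exact ((h1.1 : ContDiffOn ℂ ω _ _).restrict_scalars ℝ).of_le le_top

instance finiteDimensional_tangentSpace [FiniteDimensional ℂ E] (x : X) :
    FiniteDimensional ℝ (TangentSpace 𝓘(ℝ, E) x) :=
  inferInstanceAs (FiniteDimensional ℝ E)

/-- The complex structure `J` on the real tangent space at `x`: multiplication by `i` in a
holomorphic chart. On a complex manifold this does not depend on the chart. -/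
def complexStructure (x : X) : TangentSpace 𝓘(ℝ, E) x →ₗ[ℝ] TangentSpace 𝓘(ℝ, E) x :=
  show E →ₗ[ℝ] E from (Complex.I • (LinearMap.id : E →ₗ[ℂ] E)).restrictScalars ℝ

theorem complexStructure_sq (x : X) (v : TangentSpace 𝓘(ℝ, E) x) :
    complexStructure x (complexStructure x v) = -v := by
  change Complex.I • Complex.I • (show E from v) = -(show E from v)
  rw [smul_smul, Complex.I_mul_I, neg_one_smul]

variable [IsManifold 𝓘(ℂ, E) ω X] [RiemannianBundle (fun x : X => TangentSpace 𝓘(ℝ, E) x)]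

variable (E X) in
/-- The Riemannian metric `g` of a complex manifold is Kähler: it is Hermitian, and the form
`ω(u, v) = g(J u, v)` is closed. The exterior derivative is expressed by the formula
`dω(U, V, W) = U ω(V, W) - V ω(U, W) + W ω(U, V) - ω([U, V], W) + ω([U, W], V) - ω([V, W], U)`. -/
structure IsKaehler : Prop where
  hermitian (x : X) (u v : TangentSpace 𝓘(ℝ, E) x) :
    inner ℝ (complexStructure x u) (complexStructure x v) = inner ℝ u v
  closed {x : X} {U V W : Π y : X, TangentSpace 𝓘(ℝ, E) y}
    (hU : MDifferentiableAt 𝓘(ℝ, E) 𝓘(ℝ, E).tangent (T% U) x)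
    (hV : MDifferentiableAt 𝓘(ℝ, E) 𝓘(ℝ, E).tangent (T% V) x)
    (hW : MDifferentiableAt 𝓘(ℝ, E) 𝓘(ℝ, E).tangent (T% W) x) :
    mvfderiv 𝓘(ℝ, E) (fun y => inner ℝ (complexStructure y (V y)) (W y)) x (U x)
    - mvfderiv 𝓘(ℝ, E) (fun y => inner ℝ (complexStructure y (U y)) (W y)) x (V x)
    + mvfderiv 𝓘(ℝ, E) (fun y => inner ℝ (complexStructure y (U y)) (V y)) x (W x)
    - inner ℝ (complexStructure x (VectorField.mlieBracket 𝓘(ℝ, E) U V x)) (W x)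
    + inner ℝ (complexStructure x (VectorField.mlieBracket 𝓘(ℝ, E) U W x)) (V x)
    - inner ℝ (complexStructure x (VectorField.mlieBracket 𝓘(ℝ, E) V W x)) (U x) = 0

/-- The Kähler form `ω(u, v) = g(J u, v)` at `x`. -/
def IsKaehler.form (hX : IsKaehler E X) (x : X) : TangentSpace 𝓘(ℝ, E) x [⋀^Fin 2]→ₗ[ℝ] ℝ :=
  fundamentalForm (complexStructure x) (complexStructure_sq x) (hX.hermitian x)

end Kaehler

/-! ### Hermitian line bundles, Hermitian connections and their curvature -/

section LineBundle

variable {E : Type*} [NormedAddCommGroup E] [NormedSpace ℝ E]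
  {X : Type*} [TopologicalSpace X] [ChartedSpace E X]
  {L : X → Type*} [TopologicalSpace (TotalSpace ℂ L)]
  [∀ x, AddCommGroup (L x)] [∀ x, Module ℂ (L x)] [∀ x, TopologicalSpace (L x)]
  [FiberBundle ℂ L]

variable (L) in
/-- The local section near `x` that is constant equal to `1` in the preferred trivialization of
the line bundle at `x`. -/
def localFrame (x : X) : Π y : X, L y :=
  FiberBundle.extend ℂ ((trivializationAt ℂ L x).symm x (1 : ℂ))

theorem contMDiffAt_localFrame (x : X) :
    ContMDiffAt 𝓘(ℝ, E) (𝓘(ℝ, E).prod 𝓘(ℝ, ℂ)) ∞ (T% (localFrame L x)) x :=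
  FiberBundle.contMDiffAt_extend 𝓘(ℝ, E) ℂ _

variable (E L) in
/-- A smooth Hermitian metric on a complex line bundle (conjugate-linear in the first variable). -/
structure HermitianMetric where
  /-- The Hermitian inner product on the fibre over `x`. -/
  inner (x : X) : L x →ₗ⋆[ℂ] L x →ₗ[ℂ] ℂ
  conj_symm (x : X) (s t : L x) : starRingEnd ℂ (inner x s t) = inner x t s
  pos (x : X) (s : L x) (hs : s ≠ 0) : 0 < (inner x s s).re
  smooth {x : X} {s t : Π y : X, L y}
    (hs : ContMDiffAt 𝓘(ℝ, E) (𝓘(ℝ, E).prod 𝓘(ℝ, ℂ)) ∞ (T% s) x)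
    (ht : ContMDiffAt 𝓘(ℝ, E) (𝓘(ℝ, E).prod 𝓘(ℝ, ℂ)) ∞ (T% t) x) :
    ContMDiffAt 𝓘(ℝ, E) 𝓘(ℝ, ℂ) ∞ (fun y => inner y (s y) (t y)) x

variable [∀ x, IsTopologicalAddGroup (L x)] [∀ x, ContinuousSMul ℝ (L x)]
  [VectorBundle ℝ ℂ L] [IsManifold 𝓘(ℝ, E) ∞ X]

/-- A smooth connection on a complex line bundle that is compatible with a Hermitian metric `h`:
`d h(s, t) = h(∇ s, t) + h(s, ∇ t)`; `∇ s` is smooth wherever the section `s` is. As in `CovariantDerivative`, the value of `∇_u s` at `x`, for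
a tangent vector `u` at `x`, is written `D s x u`. -/
structure HermitianConnection (h : HermitianMetric E L) extends
    CovariantDerivative 𝓘(ℝ, E) ℂ L where
  leibniz_complex {x : X} {s : Π y : X, L y} {f : X → ℂ}
    (hs : MDifferentiableAt 𝓘(ℝ, E) (𝓘(ℝ, E).prod 𝓘(ℝ, ℂ)) (T% s) x)
    (hf : MDifferentiableAt 𝓘(ℝ, E) 𝓘(ℝ, ℂ) f x) (u : TangentSpace 𝓘(ℝ, E) x) :
    toFun (fun y => f y • s y) x u = f x • toFun s x u + mvfderiv 𝓘(ℝ, E) f x u • s x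
  metric {x : X} {s t : Π y : X, L y}
    (hs : MDifferentiableAt 𝓘(ℝ, E) (𝓘(ℝ, E).prod 𝓘(ℝ, ℂ)) (T% s) x)
    (ht : MDifferentiableAt 𝓘(ℝ, E) (𝓘(ℝ, E).prod 𝓘(ℝ, ℂ)) (T% t) x)
    (u : TangentSpace 𝓘(ℝ, E) x) :
    mvfderiv 𝓘(ℝ, E) (fun y => h.inner y (s y) (t y)) x u =
      h.inner x (toFun s x u) (t x) + h.inner x (s x) (toFun t x u)
  smooth {x : X} {s : Π y : X, L y}
    (hs : ContMDiffAt 𝓘(ℝ, E) (𝓘(ℝ, E).prod 𝓘(ℝ, ℂ)) ∞ (T% s) x) :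
    ContMDiffAt 𝓘(ℝ, E) (𝓘(ℝ, E).prod 𝓘(ℝ, E →L[ℝ] ℂ)) ∞
      (fun y => TotalSpace.mk' (E →L[ℝ] ℂ)
        (E := fun y => TangentSpace 𝓘(ℝ, E) y →L[ℝ] L y) y (toFun s y)) x

namespace HermitianConnection

variable {h : HermitianMetric E L} (D : HermitianConnection h)

/-- The curvature operator
`R(U, V) s = ∇_U ∇_V s - ∇_V ∇_U s - ∇_[U, V] s` at `x`, for vector fields `U`, `V`
and a section `s`. -/
def curvatureOp (s : Π y : X, L y) (x : X) (U V : Π y : X, TangentSpace 𝓘(ℝ, E) y) : L x :=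
  D.toFun (fun y => D.toFun s y (V y)) x (U x) - D.toFun (fun y => D.toFun s y (U y)) x (V x)
    - D.toFun s x (VectorField.mlieBracket 𝓘(ℝ, E) U V x)

theorem curvatureOp_swap (s : Π y : X, L y) (x : X) (U V : Π y : X, TangentSpace 𝓘(ℝ, E) y) :
    D.curvatureOp s x U V = -D.curvatureOp s x V U := by
  rw [curvatureOp, curvatureOp, VectorField.mlieBracket_swap_apply, map_neg]
  abel

variable [FiniteDimensional ℝ E]

theorem tensorial_right {x : X} {s : Π y : X, L y}
    (hs : ContMDiffAt 𝓘(ℝ, E) (𝓘(ℝ, E).prod 𝓘(ℝ, ℂ)) ∞ (T% s) x)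
    (U : Π y : X, TangentSpace 𝓘(ℝ, E) y) :
    TensorialAt 𝓘(ℝ, E) E (D.curvatureOp s x U) x := by
  have hD : ∀ V : Π y : X, TangentSpace 𝓘(ℝ, E) y, MDiffAt (T% V) x →
      MDifferentiableAt 𝓘(ℝ, E) (𝓘(ℝ, E).prod 𝓘(ℝ, ℂ))
        (T% (fun y => D.toFun s y (V y))) x := fun V hV =>
    ((D.smooth hs).mdifferentiableAt (by simp)).clm_bundle_apply hV
  have : CompleteSpace E := FiniteDimensional.complete ℝ E
  constructor
  · intro f V hf hV
    have h1 : (fun y => D.toFun s y ((f • V) y)) = f • (fun y => D.toFun s y (V y)) := by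
      funext y; simp
    have h2 := D.isCovariantDerivativeOnUniv.leibniz (hD V hV) hf
    simp only [curvatureOp]
    rw [h1, h2, VectorField.mlieBracket_smul_right hf hV]
    simp
    module
  · intro V V' hV hV'
    have h1 : (fun y => D.toFun s y ((V + V') y)) =
        (fun y => D.toFun s y (V y)) + (fun y => D.toFun s y (V' y)) := by
      funext y; simp
    have h2 := D.isCovariantDerivativeOnUniv.add (hD V hV) (hD V' hV')
    simp only [curvatureOp]
    rw [h1, h2, VectorField.mlieBracket_add_right hV hV']
    simp
    module

theorem tensorial_left {x : X} {s : Π y : X, L y}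
    (hs : ContMDiffAt 𝓘(ℝ, E) (𝓘(ℝ, E).prod 𝓘(ℝ, ℂ)) ∞ (T% s) x)
    (V : Π y : X, TangentSpace 𝓘(ℝ, E) y) :
    TensorialAt 𝓘(ℝ, E) E (fun U => D.curvatureOp s x U V) x := by
  have := D.tensorial_right hs V
  constructor
  · intro f U hf hU
    rw [curvatureOp_swap, this.smul hf hU, curvatureOp_swap D s x U V, smul_neg]
  · intro U U' hU hU'
    rw [curvatureOp_swap, this.add hU hU', curvatureOp_swap D s x U V, curvatureOp_swap D s x U' V,
      neg_add]

/-- The operator `(u, v) ↦ R(u, v) s` on tangent vectors at `x`, for `s = localFrame L x`. -/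
def curvatureHom (x : X) :
    TangentSpace 𝓘(ℝ, E) x →L[ℝ] TangentSpace 𝓘(ℝ, E) x →L[ℝ] L x :=
  TensorialAt.mkHom₂ (D.curvatureOp (localFrame L x) x) x
    (fun V _ => D.tensorial_left (contMDiffAt_localFrame x) V)
    (fun U _ => D.tensorial_right (contMDiffAt_localFrame x) U)

theorem curvatureHom_apply (x : X) {U V : Π y : X, TangentSpace 𝓘(ℝ, E) y}
    (hU : MDifferentiableAt 𝓘(ℝ, E) 𝓘(ℝ, E).tangent (T% U) x)
    (hV : MDifferentiableAt 𝓘(ℝ, E) 𝓘(ℝ, E).tangent (T% V) x) :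
    D.curvatureHom x (U x) (V x) = D.curvatureOp (localFrame L x) x U V :=
  TensorialAt.mkHom₂_apply _ _ hU hV

theorem curvatureHom_self (x : X) (v : TangentSpace 𝓘(ℝ, E) x) : D.curvatureHom x v v = 0 := by
  change D.curvatureOp _ x (FiberBundle.extend E v) (FiberBundle.extend E v) = 0
  simp [curvatureOp]

/-- The curvature 2-form `F` of a connection on a complex line bundle, as a complex-valued 2-form
at `x`. It is defined by `R(U, V) s = F(U, V) s` for the smooth section `s = localFrame L x`, which
has the coordinate `1` in the preferred trivialization of the line bundle at `x`. -/
def curvature (x : X) : TangentSpace 𝓘(ℝ, E) x [⋀^Fin 2]→ₗ[ℝ] ℂ :=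
  let c : L x →ₗ[ℝ] ℂ := (trivializationAt ℂ L x).linearMapAt ℝ x
  twoFormOfBilin
    (LinearMap.mk₂ ℝ (fun u v => c (D.curvatureHom x u v)) (fun _ _ _ => by simp)
      (fun _ _ _ => by simp) (fun _ _ _ => by simp) (fun _ _ _ => by simp))
    fun v => by simp [D.curvatureHom_self x v]

/-- The property that characterizes the curvature 2-form. -/
theorem curvatureOp_localFrame [VectorBundle ℂ ℂ L] (x : X)
    {U V : Π y : X, TangentSpace 𝓘(ℝ, E) y}
    (hU : MDifferentiableAt 𝓘(ℝ, E) 𝓘(ℝ, E).tangent (T% U) x)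
    (hV : MDifferentiableAt 𝓘(ℝ, E) 𝓘(ℝ, E).tangent (T% V) x) :
    D.curvatureOp (localFrame L x) x U V = D.curvature x ![U x, V x] • localFrame L x x := by
  have hx : x ∈ (trivializationAt ℂ L x).baseSet := FiberBundle.mem_baseSet_trivializationAt ℂ L x
  have h1 : D.curvature x ![U x, V x] =
      (trivializationAt ℂ L x).linearMapAt ℝ x (D.curvatureOp (localFrame L x) x U V) := by
    rw [← D.curvatureHom_apply x hU hV]
    rfl
  have h2 : (trivializationAt ℂ L x ⟨x, localFrame L x x⟩).2 = 1 := by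
    simp [localFrame, Trivialization.apply_mk_symm _ hx]
  rw [h1, Trivialization.coe_linearMapAt_of_mem _ hx]
  apply ((trivializationAt ℂ L x).continuousLinearEquivAt ℂ x hx).injective
  rw [map_smul]
  simp [h2]

end HermitianConnection

end LineBundle

/-! ### Deformed Hermitian Yang-Mills connections in complex dimension three -/

section DHYM

variable {E : Type*} [NormedAddCommGroup E] [NormedSpace ℂ E] [FiniteDimensional ℂ E]
  {X : Type*} [TopologicalSpace X] [ChartedSpace E X] [IsManifold 𝓘(ℂ, E) ω X]
  [RiemannianBundle (fun x : X => TangentSpace 𝓘(ℝ, E) x)] (hX : IsKaehler E X)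
  {L : X → Type*} [TopologicalSpace (TotalSpace ℂ L)]
  [∀ x, AddCommGroup (L x)] [∀ x, Module ℂ (L x)] [∀ x, TopologicalSpace (L x)]
  [∀ x, IsTopologicalAddGroup (L x)] [∀ x, ContinuousSMul ℝ (L x)]
  [FiberBundle ℂ L] [VectorBundle ℝ ℂ L]
  {h : HermitianMetric E L} (D : HermitianConnection h)

/-- The complex-valued 2-form `ω + F` at `x`. -/
def kaehlerAddCurvature (x : X) : TangentSpace 𝓘(ℝ, E) x [⋀^Fin 2]→ₗ[ℝ] ℂ :=
  ofRealForm (hX.form x) + D.curvature x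

/-- The real 2-form `-i F` at `x` (the curvature of a Hermitian connection takes imaginary
values). -/
def realCurvature (x : X) : TangentSpace 𝓘(ℝ, E) x [⋀^Fin 2]→ₗ[ℝ] ℝ :=
  reForm (-Complex.I • D.curvature x)

/-- The determinant `det (id + (-i F)^♯)` at `x`. -/
def detCurvature (x : X) : ℝ :=
  LinearMap.det (LinearMap.id + sharp (realCurvature D x))

/-- The complex-valued 6-form `(ω + F)³ / 3!` at `x`. -/
def cubeForm (x : X) : TangentSpace 𝓘(ℝ, E) x [⋀^Fin 6]→ₗ[ℝ] ℂ :=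
  ((Nat.factorial 3 : ℂ))⁻¹ • wedgeCube (kaehlerAddCurvature hX D x)

/-- The complex-valued 4-form `(ω + F)² / 2!` at `x`. -/
def squareForm (x : X) : TangentSpace 𝓘(ℝ, E) x [⋀^Fin 4]→ₗ[ℝ] ℂ :=
  ((Nat.factorial 2 : ℂ))⁻¹ • wedgeSq (kaehlerAddCurvature hX D x)

/-- On a Kähler manifold of complex dimension three, `D` is a deformed Hermitian Yang-Mills
connection with phase `e^{iθ}`: `π^{⟦2, 0⟧}(-i F) = 0` and `Im (e^{-iθ} (ω + F)³) = 0`. -/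
def IsDHYM (θ : ℝ) : Prop :=
  ∀ x : X, typeProj (complexStructure x) 2 0 (realCurvature D x) = 0 ∧
    imForm (Complex.exp (-(Complex.I * θ)) • wedgeCube (kaehlerAddCurvature hX D x)) = 0

end DHYM

end MirrorSL
end

/-! Everything reduces to linear algebra at a point once the curvature is known to be imaginary.
Differentiate h(s, s) twice with metric compatibility and antisymmetrise along commuting vector
fields: the second derivatives and the mixed terms cancel, which leaves h(F s, s) + h(s, F s) = 0
(`conj_curvature`). Hence F = i a with a = -i F real, and ω + F = ω + i a.

At a point, take an orthonormal basis e₁, J e₁, e₂, J e₂, e₃, J e₃ (`exists_adapted_basis`). The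
pullback J^* acts on forms of type (p, q) by i^(p - q), so both projections in the theorem equal (1
- J^*) / 2 (`typeProj_eq`). The coefficients of α² / 2! and α³ / 3! are Pfaffians (`wedgeSq_apply`,
`wedgeCube_apply`), and det (1 + a^♯) is a sum of squared Pfaffians (`det_one_add_skew`). The
identity thus becomes a polynomial identity in the 15 coefficients of a
(`formNorm_cube_sq_add_formNorm_square_sq`).

A unit phase preserves norms, so |Re|² + |Im|² + 2 |π|² equals the determinant. This gives the
inequality, with equality exactly when Im and π vanish. The imaginary part of π is ω ∧ π^{⟦2,0⟧} a,
and in complex dimension three ω ∧ · is injective on ⟦Λ^{2,0}⟧, so π = 0 forces π^{⟦2,0⟧} a = 0.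
Conversely, if a is J-invariant, so are ω + i a and its square, and π = 0. -/

noncomputable section

namespace MirrorSL

/-! ### Commuting coordinate vector fields -/

section CoordinateFields

variable {E : Type*} [NormedAddCommGroup E] [NormedSpace ℝ E]
  {X : Type*} [TopologicalSpace X] [ChartedSpace E X]

/-- The vector field near `x` that is constant equal to `v` in the preferred chart at `x`. -/
def coordField (x : X) (v : E) : Π y : X, TangentSpace 𝓘(ℝ, E) y :=
  VectorField.mpullback 𝓘(ℝ, E) 𝓘(ℝ, E) (extChartAt 𝓘(ℝ, E) x)
    (fun y : E => (show TangentSpace 𝓘(ℝ, E) y from v))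

theorem contMDiffAt_const_field {n : ℕ∞ω} (v p : E) :
    ContMDiffAt 𝓘(ℝ, E) 𝓘(ℝ, E).tangent n
      (T% (fun y : E => (show TangentSpace 𝓘(ℝ, E) y from v))) p := by
  rw [contMDiffAt_vectorSpace_iff_contDiffAt]
  exact contDiffAt_const

theorem mdifferentiableAt_const_field (v p : E) :
    MDifferentiableAt 𝓘(ℝ, E) 𝓘(ℝ, E).tangent
      (T% (fun y : E => (show TangentSpace 𝓘(ℝ, E) y from v))) p :=
  (contMDiffAt_const_field (n := 1) v p).mdifferentiableAt one_ne_zero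

variable [IsManifold 𝓘(ℝ, E) ∞ X]

theorem mfderiv_coordField (x : X) (v : E) {y : X}
    (hy : y ∈ (extChartAt 𝓘(ℝ, E) x).source) :
    mfderiv 𝓘(ℝ, E) 𝓘(ℝ, E) (extChartAt 𝓘(ℝ, E) x) y (coordField x v y) = v := by
  have : IsManifold 𝓘(ℝ, E) 1 X := IsManifold.of_le (n := ∞) (by simp)
  have hinv := isInvertible_mfderiv_extChartAt (I := 𝓘(ℝ, E)) hy
  exact hinv.self_apply_inverse v

theorem contMDiffAt_coordField [CompleteSpace E] (x : X) (v : E) :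
    ContMDiffAt 𝓘(ℝ, E) 𝓘(ℝ, E).tangent ∞ (T% (coordField x v)) x := by
  have : IsManifold 𝓘(ℝ, E) 1 X := IsManifold.of_le (n := ∞) (by simp)
  refine ContMDiffAt.mpullback_vectorField_preimage (n := ∞) ?_ contMDiffAt_extChartAt
    (isInvertible_mfderiv_extChartAt (mem_extChartAt_source x)) (by simp)
  exact contMDiffAt_const_field v _

/-- The chart has invertible differential, so tensorial identities at `x` need only be tested on
coordinate fields. -/
theorem exists_coordField_apply (x : X) (u : TangentSpace 𝓘(ℝ, E) x) :
    ∃ v : E, coordField x v x = u := by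
  have : IsManifold 𝓘(ℝ, E) 1 X := IsManifold.of_le (n := ∞) (by simp)
  have hinv := isInvertible_mfderiv_extChartAt (I := 𝓘(ℝ, E))
    (mem_extChartAt_source (I := 𝓘(ℝ, E)) x)
  exact ⟨mfderiv 𝓘(ℝ, E) 𝓘(ℝ, E) (extChartAt 𝓘(ℝ, E) x) x u, hinv.inverse_apply_self u⟩

/-- Pullback commutes with brackets, and constant fields commute. This removes the ∇_[U, V] term
from the curvature. -/
theorem mlieBracket_coordField [CompleteSpace E] (x : X) (u v : E) :
    VectorField.mlieBracket 𝓘(ℝ, E) (coordField x u) (coordField x v) x = 0 := by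
  have : IsManifold 𝓘(ℝ, E) 2 X := IsManifold.of_le (n := ∞) ENat.LEInfty.out
  have : IsManifold 𝓘(ℝ, E) (minSmoothness ℝ 3) X :=
    IsManifold.of_le (n := ∞) (by simpa using (ENat.LEInfty.out : (3 : ℕ∞ω) ≤ ∞))
  have := VectorField.mpullback_mlieBracket (n := 2) (x₀ := x) (I := 𝓘(ℝ, E)) (I' := 𝓘(ℝ, E))
    (f := extChartAt 𝓘(ℝ, E) x)
    (mdifferentiableAt_const_field u _) (mdifferentiableAt_const_field v _)
    contMDiffAt_extChartAt (by simp)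
  refine this.symm.trans ?_
  rw [VectorField.mpullback_apply]
  have h0 : VectorField.mlieBracket 𝓘(ℝ, E) (fun y : E => (show TangentSpace 𝓘(ℝ, E) y from u))
      (fun y : E => (show TangentSpace 𝓘(ℝ, E) y from v)) (extChartAt 𝓘(ℝ, E) x x) = 0 := by
    rw [← VectorField.mlieBracketWithin_univ, VectorField.mlieBracketWithin_eq_lieBracketWithin]
    change VectorField.lieBracketWithin ℝ (fun _ : E => u) (fun _ : E => v) _ _ = 0
    simp [VectorField.lieBracketWithin]
  rw [h0, map_zero]

/-- Second derivatives along coordinate fields commute. -/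
theorem mvfderiv_coordField_comm {F : Type*} [NormedAddCommGroup F] [NormedSpace ℝ F]
    {φ : X → F} {x : X} (hφ : ContMDiffAt 𝓘(ℝ, E) 𝓘(ℝ, F) ∞ φ x) (u v : E) :
    mvfderiv 𝓘(ℝ, E) (fun y => mvfderiv 𝓘(ℝ, E) φ y (coordField x v y)) x (coordField x u x) =
    mvfderiv 𝓘(ℝ, E) (fun y => mvfderiv 𝓘(ℝ, E) φ y (coordField x u y)) x (coordField x v x) := by
  have : IsManifold 𝓘(ℝ, E) 1 X := IsManifold.of_le (n := ∞) (by simp)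
  set χ := extChartAt 𝓘(ℝ, E) x with hχ
  set ψ : E → F := φ ∘ χ.symm with hψ
  have hψ2 : ContDiffAt ℝ 2 ψ (χ x) := by
    have h1 := (contMDiffAt_iff.1 hφ).2
    simp only [extChartAt_model_space_eq_id, modelWithCornersSelf_coe, Set.range_id,
      contDiffWithinAt_univ] at h1
    exact ContDiffAt.of_le h1 ENat.LEInfty.out
  have hψd : ∀ᶠ y in nhds x, DifferentiableAt ℝ ψ (χ y) := by
    have h1 : ∀ᶠ z in nhds (χ x), ContDiffAt ℝ 2 ψ z := hψ2.eventually (by simp)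
    have h2 : ContinuousAt χ x := continuousAt_extChartAt x
    filter_upwards [h2.eventually h1] with y hy
    exact hy.differentiableAt (by simp)
  -- The equality is needed on a whole neighbourhood of `x`, because this function is differentiated
  -- once more.
  have key (w : E) : (fun y => mvfderiv 𝓘(ℝ, E) φ y (coordField x w y)) =ᶠ[nhds x]
      (fun z => fderiv ℝ ψ z w) ∘ χ := by
    filter_upwards [hψd, extChartAt_source_mem_nhds (I := 𝓘(ℝ, E)) x] with y hy hys
    have h1 : φ =ᶠ[nhds y] ψ ∘ χ := by
      filter_upwards [extChartAt_source_mem_nhds' (I := 𝓘(ℝ, E)) hys] with z hz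
      simp only [hψ, hχ, Function.comp_apply, (extChartAt 𝓘(ℝ, E) x).left_inv hz]
    have hχd : MDifferentiableAt 𝓘(ℝ, E) 𝓘(ℝ, E) χ y :=
      mdifferentiableAt_extChartAt (by simpa using hys)
    rw [mvfderiv, h1.mfderiv_eq]
    change mfderiv 𝓘(ℝ, E) 𝓘(ℝ, F) (ψ ∘ χ) y _ = _
    rw [mfderiv_comp_apply y hy.mdifferentiableAt hχd, mfderiv_coordField x w hys,
      mfderiv_eq_fderiv]
    rfl
  have hsnd : DifferentiableAt ℝ (fderiv ℝ ψ) (χ x) :=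
    (hψ2.fderiv_right (m := 1) (by norm_num)).differentiableAt (by simp)
  have key2 (w t : E) : mvfderiv 𝓘(ℝ, E) (fun y => mvfderiv 𝓘(ℝ, E) φ y (coordField x w y)) x
      (coordField x t x) = fderiv ℝ (fderiv ℝ ψ) (χ x) t w := by
    have hw : DifferentiableAt ℝ (fun z => fderiv ℝ ψ z w) (χ x) := hsnd.clm_apply (by simp)
    rw [mvfderiv, (key w).mfderiv_eq]
    change mfderiv 𝓘(ℝ, E) 𝓘(ℝ, F) ((fun z => fderiv ℝ ψ z w) ∘ χ) x _ = _
    rw [mfderiv_comp_apply x hw.mdifferentiableAt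
      (mdifferentiableAt_extChartAt (mem_chart_source E x)),
      mfderiv_coordField x t (mem_extChartAt_source x), mfderiv_eq_fderiv]
    change fderiv ℝ (fun z => fderiv ℝ ψ z w) (χ x) t = _
    rw [fderiv_clm_apply hsnd (by simp)]
    simp
  rw [key2, key2]
  exact (hψ2.isSymmSndFDerivAt (by simp)) u v

end CoordinateFields

/-! ### Curvature of a Hermitian connection is imaginary -/

section ImaginaryCurvature

variable {E : Type*} [NormedAddCommGroup E] [NormedSpace ℝ E]
  {X : Type*} [TopologicalSpace X] [ChartedSpace E X]
  {L : X → Type*} [TopologicalSpace (TotalSpace ℂ L)]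
  [∀ x, AddCommGroup (L x)] [∀ x, Module ℂ (L x)] [∀ x, TopologicalSpace (L x)]
  [FiberBundle ℂ L]
  [∀ x, IsTopologicalAddGroup (L x)] [∀ x, ContinuousSMul ℝ (L x)]
  [VectorBundle ℝ ℂ L] [IsManifold 𝓘(ℝ, E) ∞ X]
  [ContMDiffVectorBundle ∞ ℂ L 𝓘(ℝ, E)]
  {h : HermitianMetric E L} (D : HermitianConnection h)

namespace HermitianConnection

/-- Differentiating the metric compatibility twice along coordinate fields. -/
theorem mvfderiv_mvfderiv_inner {x : X} {s : Π y : X, L y}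
    (hs : ContMDiffAt 𝓘(ℝ, E) (𝓘(ℝ, E).prod 𝓘(ℝ, ℂ)) ∞ (T% s) x)
    {V : Π y : X, TangentSpace 𝓘(ℝ, E) y}
    (hV : ContMDiffAt 𝓘(ℝ, E) 𝓘(ℝ, E).tangent ∞ (T% V) x) (u : TangentSpace 𝓘(ℝ, E) x) :
    mvfderiv 𝓘(ℝ, E) (fun y => mvfderiv 𝓘(ℝ, E) (fun z => h.inner z (s z) (s z)) y (V y)) x u =
      h.inner x (D.toFun (fun y => D.toFun s y (V y)) x u) (s x)
      + h.inner x (D.toFun s x (V x)) (D.toFun s x u)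
      + (h.inner x (D.toFun s x u) (D.toFun s x (V x))
      + h.inner x (s x) (D.toFun (fun y => D.toFun s y (V y)) x u)) := by
  have : IsManifold (𝓘(ℝ, E).prod 𝓘(ℝ, ℂ)) ∞ (TotalSpace ℂ L) := inferInstance
  have : IsManifold (𝓘(ℝ, E).prod 𝓘(ℝ, ℂ)) 1 (TotalSpace ℂ L) :=
    IsManifold.of_le (n := ∞) (by simp)
  have : IsManifold 𝓘(ℝ, E) 1 X := IsManifold.of_le (n := ∞) (by simp)
  have hsd : MDifferentiableAt 𝓘(ℝ, E) (𝓘(ℝ, E).prod 𝓘(ℝ, ℂ)) (T% s) x :=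
    hs.mdifferentiableAt (by simp)
  have hDV : ContMDiffAt 𝓘(ℝ, E) (𝓘(ℝ, E).prod 𝓘(ℝ, ℂ)) ∞
      (T% (fun y => D.toFun s y (V y))) x :=
    (D.smooth hs).clm_bundle_apply hV
  have hDVd := hDV.mdifferentiableAt (by simp)
  -- Metric compatibility must hold at all nearby points before it is differentiated again.
  -- Smoothness at a point spreads to a neighbourhood only for finite order, hence the drop from ∞
  -- to 1.
  have hev : ∀ᶠ y in nhds x, ContMDiffAt 𝓘(ℝ, E) (𝓘(ℝ, E).prod 𝓘(ℝ, ℂ)) 1 (T% s) y :=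
    (contMDiffAt_iff_contMDiffAt_nhds (by simp)).1 (hs.of_le (by simp))
  have heq : (fun y => mvfderiv 𝓘(ℝ, E) (fun z => h.inner z (s z) (s z)) y (V y)) =ᶠ[nhds x]
      (fun y => h.inner y (D.toFun s y (V y)) (s y))
        + (fun y => h.inner y (s y) (D.toFun s y (V y))) := by
    filter_upwards [hev] with y hy
    exact D.metric (hy.mdifferentiableAt (by simp)) (hy.mdifferentiableAt (by simp)) (V y)
  rw [mvfderiv, heq.mfderiv_eq]
  change mvfderiv 𝓘(ℝ, E) _ x u = _
  rw [mvfderiv_add ((h.smooth hDV hs).mdifferentiableAt (by simp))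
    ((h.smooth hs hDV).mdifferentiableAt (by simp)), add_apply,
    D.metric hDVd hsd, D.metric hsd hDVd]

variable [FiniteDimensional ℝ E] [VectorBundle ℂ ℂ L]

/-- The curvature of a Hermitian connection takes imaginary values. -/
theorem conj_curvature (x : X) (u v : TangentSpace 𝓘(ℝ, E) x) :
    starRingEnd ℂ (D.curvature x ![u, v]) = -D.curvature x ![u, v] := by
  have : CompleteSpace E := FiniteDimensional.complete ℝ E
  obtain ⟨u, rfl⟩ := exists_coordField_apply x u
  obtain ⟨v, rfl⟩ := exists_coordField_apply x v
  have hU := contMDiffAt_coordField x u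
  have hV := contMDiffAt_coordField x v
  have hs := contMDiffAt_localFrame (E := E) (L := L) x
  set s := localFrame L x with hsdef
  have h1 := D.mvfderiv_mvfderiv_inner hs hV (coordField x u x)
  have h2 := D.mvfderiv_mvfderiv_inner hs hU (coordField x v x)
  rw [mvfderiv_coordField_comm (h.smooth hs hs) u v, h2] at h1
  have hR := D.curvatureOp_localFrame x (hU.mdifferentiableAt (by simp))
    (hV.mdifferentiableAt (by simp))
  rw [HermitianConnection.curvatureOp, mlieBracket_coordField, map_zero, sub_zero] at hR
  -- The terms h(∇_V s, ∇_U s) + h(∇_U s, ∇_V s) are symmetric in U and V, so they cancel in the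
  -- difference `h1`.
  have h3 : h.inner x (D.curvature x ![coordField x u x, coordField x v x] • s x) (s x)
      + h.inner x (s x) (D.curvature x ![coordField x u x, coordField x v x] • s x) = 0 := by
    rw [hsdef, ← hR]
    simp only [map_sub, LinearMap.sub_apply]
    linear_combination h1.symm
  simp only [LinearMap.map_smulₛₗ, LinearMap.smul_apply, smul_eq_mul, RingHom.id_apply] at h3
  rw [← add_mul] at h3
  have hne : s x ≠ 0 := by
    intro h0
    have hx : x ∈ (trivializationAt ℂ L x).baseSet := FiberBundle.mem_baseSet_trivializationAt ℂ L x
    have h2 : (trivializationAt ℂ L x ⟨x, localFrame L x x⟩).2 = 1 := by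
      simp [localFrame, Trivialization.apply_mk_symm _ hx]
    have h4 := map_zero ((trivializationAt ℂ L x).continuousLinearEquivAt ℂ x hx)
    rw [← h0] at h4
    simp [hsdef, h2] at h4
  have hpos : h.inner x (s x) (s x) ≠ 0 := by
    intro h0
    have := h.pos x (s x) hne
    simp [h0] at this
  exact eq_neg_of_add_eq_zero_left ((mul_eq_zero.1 h3).resolve_right hpos)

end HermitianConnection

end ImaginaryCurvature

/-! ### Exterior products: expansion in a basis and Laplace expansion -/

section FormAlgebra

variable {V : Type*} [AddCommGroup V] [Module ℝ V] {k p q : ℕ}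

theorem form_sum_apply {W ι : Type*} [AddCommGroup W] [Module ℝ W] (s : Finset ι)
    (α : ι → V [⋀^Fin k]→ₗ[ℝ] W) (v : Fin k → V) : (∑ i ∈ s, α i) v = ∑ i ∈ s, α i v :=
  map_sum (⟨⟨fun β : V [⋀^Fin k]→ₗ[ℝ] W => β v, rfl⟩, fun _ _ => rfl⟩ :
    (V [⋀^Fin k]→ₗ[ℝ] W) →+ W) α s

/-- The exterior product as a normalized sum over all permutations. -/
theorem factorial_mul_wedge_apply (α : V [⋀^Fin p]→ₗ[ℝ] ℂ) (β : V [⋀^Fin q]→ₗ[ℝ] ℂ)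
    (v : Fin (p + q) → V) :
    ((p.factorial * q.factorial : ℕ) : ℂ) * wedge α β v =
      ∑ σ : Equiv.Perm (Fin p ⊕ Fin q), ((Equiv.Perm.sign σ : ℤ) : ℂ) *
        (α (fun i => v (finSumFinEquiv (σ (Sum.inl i)))) *
          β (fun i => v (finSumFinEquiv (σ (Sum.inr i))))) := by
  have h := MultilinearMap.domCoprod_alternization_eq α β
  have h' := congrArg (fun f => LinearMap.mul' ℝ ℂ (f (v ∘ finSumFinEquiv))) h
  simp only [Fintype.card_fin, AlternatingMap.smul_apply, map_nsmul,
    MultilinearMap.alternatization_apply, map_sum, MultilinearMap.domDomCongr_apply,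
    MultilinearMap.domCoprod_apply] at h'
  rw [nsmul_eq_mul] at h'
  refine h'.symm.trans (Finset.sum_congr rfl fun σ _ => ?_)
  rw [Units.smul_def, map_zsmul, zsmul_eq_mul]
  rfl

/-- After multiplication by p! q! the product is a plain sum over permutations, in which linearity
can be read off term by term. -/
theorem wedge_sum_smul_left {ι : Type*} (s : Finset ι) (c : ι → ℂ)
    (α : ι → V [⋀^Fin p]→ₗ[ℝ] ℂ) (β : V [⋀^Fin q]→ₗ[ℝ] ℂ) :
    wedge (∑ i ∈ s, c i • α i) β = ∑ i ∈ s, c i • wedge (α i) β := by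
  have hpq : ((p.factorial * q.factorial : ℕ) : ℂ) ≠ 0 :=
    Nat.cast_ne_zero.2 (mul_ne_zero p.factorial_ne_zero q.factorial_ne_zero)
  ext v
  apply mul_left_cancel₀ hpq
  simp only [form_sum_apply, AlternatingMap.smul_apply, smul_eq_mul, Finset.mul_sum,
    mul_left_comm _ (c _), factorial_mul_wedge_apply, Finset.sum_mul, mul_assoc]
  exact Finset.sum_comm

theorem wedge_sum_smul_right {ι : Type*} (s : Finset ι) (c : ι → ℂ)
    (α : V [⋀^Fin p]→ₗ[ℝ] ℂ) (β : ι → V [⋀^Fin q]→ₗ[ℝ] ℂ) :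
    wedge α (∑ i ∈ s, c i • β i) = ∑ i ∈ s, c i • wedge α (β i) := by
  have hpq : ((p.factorial * q.factorial : ℕ) : ℂ) ≠ 0 :=
    Nat.cast_ne_zero.2 (mul_ne_zero p.factorial_ne_zero q.factorial_ne_zero)
  ext v
  apply mul_left_cancel₀ hpq
  simp only [form_sum_apply, AlternatingMap.smul_apply, smul_eq_mul, Finset.mul_sum,
    mul_left_comm _ (c _), factorial_mul_wedge_apply]
  exact Finset.sum_comm

theorem wedge_compLinearMap (α : V [⋀^Fin p]→ₗ[ℝ] ℂ) (β : V [⋀^Fin q]→ₗ[ℝ] ℂ) (f : V →ₗ[ℝ] V) :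
    (wedge α β).compLinearMap f = wedge (α.compLinearMap f) (β.compLinearMap f) := by
  have hpq : ((p.factorial * q.factorial : ℕ) : ℂ) ≠ 0 :=
    Nat.cast_ne_zero.2 (mul_ne_zero p.factorial_ne_zero q.factorial_ne_zero)
  ext v
  apply mul_left_cancel₀ hpq
  simp only [AlternatingMap.compLinearMap_apply, factorial_mul_wedge_apply]

/-- The product of two alternatizations is the alternatization of the tensor product. Only the
reindexing of permutations along `finSumFinEquiv` remains. -/
theorem wedge_wedgeOneForms (a : Fin p → V →ₗ[ℝ] ℂ) (b : Fin q → V →ₗ[ℝ] ℂ) :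
    wedge (wedgeOneForms a) (wedgeOneForms b) = wedgeOneForms (Fin.append a b) := by
  ext v
  simp only [wedge, wedgeOneForms, ← MultilinearMap.domCoprod_alternization,
    AlternatingMap.domDomCongr_apply, LinearMap.compAlternatingMap_apply,
    MultilinearMap.alternatization_apply, map_sum]
  refine Fintype.sum_equiv (Equiv.permCongr finSumFinEquiv) _ _ fun σ => ?_
  rw [Units.smul_def, map_zsmul, Units.smul_def, Equiv.Perm.sign_permCongr]
  simp [Fin.prod_univ_add, Equiv.permCongr_apply]

/-- Multilinear expansion of a form in the coordinates of a basis. -/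
theorem apply_eq_sum_prod_smul {W ι : Type*} [AddCommGroup W] [Module ℝ W] [Fintype ι]
    (b : Basis ι ℝ V) (α : V [⋀^Fin k]→ₗ[ℝ] W) (w : Fin k → V) :
    α w = ∑ f : Fin k → ι, (∏ j, b.coord (f j) (w j)) • α (fun j => b (f j)) := by
  have h1 : w = fun j => ∑ i, b.repr (w j) i • b i := by
    funext j; exact (b.sum_repr (w j)).symm
  have h2 := α.toMultilinearMap.map_sum (fun j i => b.repr (w j) i • b i)
  conv_lhs => rw [h1]
  exact h2.trans (Finset.sum_congr rfl fun f _ =>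
    α.toMultilinearMap.map_smul_univ (fun j => b.repr (w j) (f j)) (fun j => b (f j)))

/-- Multilinear expansion of a complex-valued form in the coordinates of a basis. -/
theorem apply_eq_sum_prod_coord {ι : Type*} [Fintype ι] (b : Basis ι ℝ V)
    (α : V [⋀^Fin k]→ₗ[ℝ] ℂ) (w : Fin k → V) :
    α w = ∑ f : Fin k → ι, α (fun j => b (f j)) * ∏ j, ((b.coord (f j) (w j) : ℝ) : ℂ) := by
  rw [apply_eq_sum_prod_smul b α w]
  refine Finset.sum_congr rfl fun f _ => ?_
  rw [Complex.real_smul, mul_comm, Complex.ofReal_prod]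

/-- Expansion of a form in the exterior products of the coordinate 1-forms of a basis. -/
theorem eq_sum_wedgeOneForms {ι : Type*} [Fintype ι] (b : Basis ι ℝ V)
    (α : V [⋀^Fin k]→ₗ[ℝ] ℂ) :
    α = ∑ f : Fin k → ι, ((k.factorial : ℂ)⁻¹ * α (fun j => b (f j))) •
      wedgeOneForms fun j => Complex.ofRealCLM.toLinearMap ∘ₗ b.coord (f j) := by
  have hk : (k.factorial : ℂ) ≠ 0 := Nat.cast_ne_zero.2 k.factorial_ne_zero
  ext v
  apply mul_left_cancel₀ hk
  simp only [AlternatingMap.smul_apply, form_sum_apply, wedgeOneForms,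
    MultilinearMap.alternatization_apply, smul_eq_mul, Finset.mul_sum, ← mul_assoc,
    mul_inv_cancel₀ hk, one_mul]
  rw [Finset.sum_comm]
  -- Expanding α at the permuted vectors produces sign σ, which cancels the sign of the
  -- alternatization. Each of the k! permutations then contributes α v, compensating the factor 1 /
  -- k!.
  have h4 (σ : Equiv.Perm (Fin k)) : ∑ f : Fin k → ι, α (fun j => b (f j)) *
      (Equiv.Perm.sign σ • (MultilinearMap.domDomCongr σ
        ((MultilinearMap.mkPiAlgebra ℝ (Fin k) ℂ).compLinearMap
          fun j => Complex.ofRealCLM.toLinearMap ∘ₗ b.coord (f j))) v) = α v := by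
    have h5 := apply_eq_sum_prod_coord b α (fun j => v (σ j))
    have h6 : α (fun j => v (σ j)) = Equiv.Perm.sign σ • α v := α.map_perm v σ
    rw [h6] at h5
    have h7 : Equiv.Perm.sign σ • (Equiv.Perm.sign σ • α v) = α v := by
      rw [smul_smul, Int.units_mul_self, one_smul]
    rw [h5, Finset.smul_sum] at h7
    rw [← h7]
    refine Finset.sum_congr rfl fun f _ => ?_
    simp [mul_smul_comm]
  rw [Finset.sum_congr rfl fun σ _ => h4 σ]
  simp [Fintype.card_perm]

/-- Laplace expansion of the determinant along its last two columns. Their indices `p + 1` and `p`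
have odd sum, hence the overall minus sign. -/
theorem wedgeOneForms_append_two_apply (a : Fin p → V →ₗ[ℝ] ℂ) (b : Fin 2 → V →ₗ[ℝ] ℂ)
    (v : Fin (p + 2) → V) :
    wedgeOneForms (Fin.append a b) v = ∑ i : Fin (p + 2), ∑ j : Fin (p + 1),
      -(-1) ^ (i + j : ℕ) * (b 0 (v (i.succAbove j)) * b 1 (v i)) *
        wedgeOneForms a (fun l => v (i.succAbove (j.succAbove l))) := by
  rw [wedgeOneForms_apply, Matrix.det_succ_column _ (Fin.last (p + 1))]
  refine Finset.sum_congr rfl fun i _ => ?_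
  rw [Matrix.det_succ_column _ (Fin.last p), Finset.mul_sum]
  refine Finset.sum_congr rfl fun j _ => ?_
  rw [wedgeOneForms_apply]
  have e1 : Fin.append a b (Fin.last (p + 1)) = b 1 := Fin.append_right a b 1
  have e0 : Fin.append a b (Fin.last p).castSucc = b 0 := Fin.append_right a b 0
  have e (l : Fin p) : Fin.append a b l.castSucc.castSucc = a l := Fin.append_left a b l
  have hdet : ((Matrix.of fun i j => Fin.append a b j (v i)).submatrix i.succAbove
      (Fin.last (p + 1)).succAbove).submatrix j.succAbove (Fin.last p).succAbove =
      Matrix.of fun l m => a m (v (i.succAbove (j.succAbove l))) := by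
    ext l m
    simp [e]
  rw [hdet]
  simp only [Matrix.of_apply, Matrix.submatrix_apply, Fin.succAbove_last, e1, e0, Fin.val_last]
  have hp : ((-1 : ℂ) ^ p) * (-1) ^ p = 1 := by rw [← mul_pow]; simp
  rw [pow_add, pow_add, pow_add, pow_succ]
  linear_combination (-((-1) ^ (i : ℕ) * (-1) ^ (j : ℕ) * b 0 (v (i.succAbove j)) * b 1 (v i) *
    (Matrix.of fun l m => a m (v (i.succAbove (j.succAbove l)))).det)) * hp

variable [FiniteDimensional ℝ V]

/-- Laplace expansion of the exterior product with a 2-form. -/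
theorem two_mul_wedge_two_apply (β : V [⋀^Fin p]→ₗ[ℝ] ℂ) (α : V [⋀^Fin 2]→ₗ[ℝ] ℂ)
    (v : Fin (p + 2) → V) :
    2 * wedge β α v = ∑ i : Fin (p + 2), ∑ j : Fin (p + 1),
      (-1) ^ (i + j : ℕ) * α ![v i, v (i.succAbove j)] *
        β (fun l => v (i.succAbove (j.succAbove l))) := by
  -- By linearity it suffices to expand both factors into products of 1-forms, beginning with β.
  have hβ (c : Fin 2 → V →ₗ[ℝ] ℂ) : wedge β (wedgeOneForms c) v =
      ∑ i : Fin (p + 2), ∑ j : Fin (p + 1), -(-1) ^ (i + j : ℕ) *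
        (c 0 (v (i.succAbove j)) * c 1 (v i)) *
        β (fun l => v (i.succAbove (j.succAbove l))) := by
    have hβ' := eq_sum_wedgeOneForms (finBasis ℝ V) β
    set d := fun f : Fin p → Fin (finrank ℝ V) =>
      (p.factorial : ℂ)⁻¹ * β (fun j => finBasis ℝ V (f j))
    rw [hβ', wedge_sum_smul_left]
    simp only [wedge_wedgeOneForms, form_sum_apply, AlternatingMap.smul_apply, smul_eq_mul,
      wedgeOneForms_append_two_apply, Finset.mul_sum]
    rw [Finset.sum_comm]
    refine Finset.sum_congr rfl fun i _ => ?_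
    rw [Finset.sum_comm]
    exact Finset.sum_congr rfl fun j _ => Finset.sum_congr rfl fun f _ => mul_left_comm _ _ _
  have hα := apply_eq_sum_prod_coord (finBasis ℝ V) α
  conv_lhs => rw [eq_sum_wedgeOneForms (finBasis ℝ V) α, wedge_sum_smul_right]
  simp only [form_sum_apply, AlternatingMap.smul_apply, smul_eq_mul, hβ, Finset.mul_sum]
  rw [Finset.sum_comm]
  refine Finset.sum_congr rfl fun i _ => ?_
  rw [Finset.sum_comm]
  refine Finset.sum_congr rfl fun j _ => ?_
  -- The column expansion evaluates the first factor at `v (i.succAbove j)` and the second at `v i`.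
  -- Swapping them absorbs the minus sign.
  have hsw : α ![v i, v (i.succAbove j)] = -α ![v (i.succAbove j), v i] := by
    have := α.map_swap ![v (i.succAbove j), v i] (i := 0) (j := 1) (by simp)
    rw [← this]
    congr 1
    funext l
    fin_cases l <;> simp
  rw [hsw, hα, mul_neg, Finset.mul_sum, ← Finset.sum_neg_distrib, Finset.sum_mul]
  refine Finset.sum_congr rfl fun f _ => ?_
  simp [Fin.prod_univ_two]
  ring

end FormAlgebra

/-! ### Decomposition of forms into types under J -/

section Types

variable {V : Type*} [AddCommGroup V] [Module ℝ V] {k : ℕ}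

theorem wedgeOneForms_compLinearMap (a : Fin k → V →ₗ[ℝ] ℂ) (J : V →ₗ[ℝ] V) :
    (wedgeOneForms a).compLinearMap J = wedgeOneForms fun i => a i ∘ₗ J := by
  ext v
  simp [wedgeOneForms_apply]

theorem wedgeOneForms_smul (c : Fin k → ℂ) (a : Fin k → V →ₗ[ℝ] ℂ) :
    wedgeOneForms (fun i => c i • a i) = (∏ i, c i) • wedgeOneForms a := by
  ext v
  rw [AlternatingMap.smul_apply, wedgeOneForms_apply, wedgeOneForms_apply, smul_eq_mul,
    ← Matrix.det_mul_row]
  rfl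

theorem wedgeOneForms_comp_perm (a : Fin k → V →ₗ[ℝ] ℂ) (σ : Equiv.Perm (Fin k)) :
    wedgeOneForms (a ∘ σ) = ((Equiv.Perm.sign σ : ℤ) : ℂ) • wedgeOneForms a := by
  ext v
  rw [AlternatingMap.smul_apply, wedgeOneForms_apply, wedgeOneForms_apply, smul_eq_mul,
    ← Matrix.det_permute']
  rfl

theorem wedgeOneForms_add (a b : Fin k → V →ₗ[ℝ] ℂ) :
    wedgeOneForms (a + b) = ∑ s : Finset (Fin k), wedgeOneForms (s.piecewise a b) := by
  ext v
  have h := (Matrix.detRowAlternating (R := ℂ) (n := Fin k)).toMultilinearMap.map_add_univ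
    (fun j i => a j (v i)) (fun j i => b j (v i))
  have e (c : Fin k → V →ₗ[ℝ] ℂ) : wedgeOneForms c v =
      (Matrix.detRowAlternating (R := ℂ) (n := Fin k)).toMultilinearMap (fun j i => c j (v i)) := by
    rw [wedgeOneForms_apply, ← Matrix.det_transpose]
    rfl
  rw [form_sum_apply, e]
  refine h.trans (Finset.sum_congr rfl fun s _ => ?_)
  rw [e]
  congr 1
  funext j i
  by_cases hj : j ∈ s <;> simp [hj]

/-- `J` acts on forms of type `(m, k - m)` by the scalar `i ^ m (-i) ^ (k - m)`. -/
theorem compLinearMap_of_mem_formsOfType (J : V →ₗ[ℝ] V) {m : ℕ} (hm : m ≤ k)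
    {α : V [⋀^Fin k]→ₗ[ℝ] ℂ} (hα : α ∈ formsOfType J k m) :
    α.compLinearMap J = (Complex.I ^ m * (-Complex.I) ^ (k - m)) • α := by
  induction hα using Submodule.span_induction with
  | mem α h =>
    obtain ⟨a, h1, h2, rfl⟩ := h
    rw [wedgeOneForms_compLinearMap]
    have : (fun i => a i ∘ₗ J) =
        fun i : Fin k => (if (i : ℕ) < m then Complex.I else -Complex.I) • a i := by
      funext i
      ext v
      by_cases hi : (i : ℕ) < m
      · simp [hi, h1 i hi v]
      · simp [hi, h2 i (not_lt.1 hi) v]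
    rw [this, wedgeOneForms_smul]
    congr 1
    obtain ⟨n, rfl⟩ := Nat.exists_eq_add_of_le hm
    rw [Fin.prod_univ_add]
    simp
  | zero => ext v; simp
  | add α β _ _ h1 h2 =>
    rw [smul_add, ← h1, ← h2]; rfl
  | smul c α _ h =>
    rw [smul_comm, ← h]; rfl

/-- `formsOfType` lists the (1, 0) factors first; this permutation moves an arbitrary set of (1, 0)
positions to the front. -/
theorem exists_perm_mem_iff_lt_card (s : Finset (Fin k)) :
    ∃ σ : Equiv.Perm (Fin k), ∀ i, σ i ∈ s ↔ (i : ℕ) < s.card := by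
  have hs : s.card ≤ k := by simpa using s.card_le_univ
  have hc : Fintype.card {i : Fin k // (i : ℕ) < s.card} = Fintype.card {i // i ∈ s} := by
    rw [Fintype.card_coe, Fintype.card_subtype, Fin.card_filter_val_lt]
    simpa using hs
  let e := Fintype.equivOfCardEq hc
  refine ⟨e.extendSubtype, fun i => ⟨fun h => ?_, fun h => e.extendSubtype_mem i h⟩⟩
  by_contra hi
  exact e.extendSubtype_not_mem i hi h

/-- Every exterior product of 1-forms is a sum of forms of pure type. -/
theorem wedgeOneForms_mem_iSup_formsOfType {J : V →ₗ[ℝ] V} (hJ : ∀ v, J (J v) = -v)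
    (a : Fin k → V →ₗ[ℝ] ℂ) :
    ∃ α : Finset (Fin k) → V [⋀^Fin k]→ₗ[ℝ] ℂ,
      (∀ s, α s ∈ formsOfType J k s.card) ∧ wedgeOneForms a = ∑ s, α s := by
  -- The (1, 0) part (a - i a ∘ J) / 2 and the (0, 1) part (a + i a ∘ J) / 2 of each factor.
  -- Expanding the product over all choices gives the sum over subsets.
  let b : Fin k → V →ₗ[ℝ] ℂ := fun i => (2⁻¹ : ℂ) • (a i - Complex.I • (a i ∘ₗ J))
  let c : Fin k → V →ₗ[ℝ] ℂ := fun i => (2⁻¹ : ℂ) • (a i + Complex.I • (a i ∘ₗ J))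
  have hb (i : Fin k) (v : V) : b i (J v) = Complex.I * b i v := by
    simp only [b, LinearMap.smul_apply, LinearMap.sub_apply, LinearMap.comp_apply, hJ, map_neg,
      smul_eq_mul]
    linear_combination (a i (J v) / 2) * Complex.I_mul_I
  have hc (i : Fin k) (v : V) : c i (J v) = -Complex.I * c i v := by
    simp only [c, LinearMap.smul_apply, LinearMap.add_apply, LinearMap.comp_apply, hJ, map_neg,
      smul_eq_mul]
    linear_combination (a i (J v) / 2) * Complex.I_mul_I
  have hbc : a = b + c := by
    funext i
    ext v
    simp only [b, c, Pi.add_apply, LinearMap.smul_apply, LinearMap.add_apply, LinearMap.sub_apply,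
      smul_eq_mul]
    ring
  refine ⟨fun s => wedgeOneForms (s.piecewise b c), fun s => ?_, by rw [hbc, wedgeOneForms_add]⟩
  obtain ⟨σ, hσ⟩ := exists_perm_mem_iff_lt_card s
  have h1 : wedgeOneForms (s.piecewise b c ∘ σ) ∈ formsOfType J k s.card := by
    refine Submodule.subset_span ⟨_, fun i hi v => ?_, fun i hi v => ?_, rfl⟩
    · have := (hσ i).2 hi
      simp [this, hb]
    · have : σ i ∉ s := fun h => absurd ((hσ i).1 h) (not_lt.2 hi)
      simp [this, hc]
  rw [wedgeOneForms_comp_perm] at h1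
  have h2 := Submodule.smul_mem _ ((Equiv.Perm.sign σ : ℤ) : ℂ) h1
  rwa [smul_smul, ← Int.cast_mul, ← Units.val_mul, Int.units_mul_self, Units.val_one, Int.cast_one,
    one_smul] at h2

variable [FiniteDimensional ℝ V]

/-- If `J` acts trivially on all types but `(p, k - p)` and `(q, k - q)`, then `α - J^* α` has only
components of these two types. -/
theorem sub_compLinearMap_mem {J : V →ₗ[ℝ] V} (hJ : ∀ v, J (J v) = -v) {p q : ℕ}
    (h : ∀ m ≤ k, Complex.I ^ m * (-Complex.I) ^ (k - m) = 1 ∨ m = p ∨ m = q)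
    (α : V [⋀^Fin k]→ₗ[ℝ] ℂ) :
    α - α.compLinearMap J ∈ formsOfType J k p ⊔ formsOfType J k q := by
  have hlin : ∃ T : (V [⋀^Fin k]→ₗ[ℝ] ℂ) →ₗ[ℂ] (V [⋀^Fin k]→ₗ[ℝ] ℂ),
      ∀ α, T α = α - α.compLinearMap J :=
    ⟨⟨⟨fun α => α - α.compLinearMap J, fun α β => by ext v; simp; ring⟩,
      fun c α => by ext v; simp; ring⟩, fun _ => rfl⟩
  obtain ⟨T, hT⟩ := hlin
  rw [← hT, eq_sum_wedgeOneForms (finBasis ℝ V) α, map_sum]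
  refine Submodule.sum_mem _ fun f _ => ?_
  rw [map_smul]
  refine Submodule.smul_mem _ _ ?_
  obtain ⟨β, hβ, he⟩ := wedgeOneForms_mem_iSup_formsOfType hJ
    (fun j => Complex.ofRealCLM.toLinearMap ∘ₗ (finBasis ℝ V).coord (f j))
  rw [he, map_sum]
  refine Submodule.sum_mem _ fun s _ => ?_
  have hs : s.card ≤ k := by simpa using s.card_le_univ
  rw [hT, compLinearMap_of_mem_formsOfType J hs (hβ s)]
  rcases h s.card hs with h1 | h1 | h1
  · rw [h1, one_smul, sub_self]
    exact Submodule.zero_mem _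
  · have := h1 ▸ hβ s
    exact Submodule.mem_sup_left (Submodule.sub_mem _ this (Submodule.smul_mem _ _ this))
  · have := h1 ▸ hβ s
    exact Submodule.mem_sup_right (Submodule.sub_mem _ this (Submodule.smul_mem _ _ this))

end Types

/-! ### The type projections as (1 - J^*) / 2 -/

section Projection

variable {V : Type*} [NormedAddCommGroup V] [InnerProductSpace ℝ V] [FiniteDimensional ℝ V] {k : ℕ}

/-- `formInner` can be computed in any orthonormal basis. -/
theorem formInner_eq_sum {ι : Type*} [Fintype ι] (b : OrthonormalBasis ι ℝ V)
    (α β : V [⋀^Fin k]→ₗ[ℝ] ℝ) :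
    formInner α β = (k.factorial : ℝ)⁻¹ *
      ∑ f : Fin k → ι, α (fun j => b (f j)) * β (fun j => b (f j)) := by
  classical
  have hexp (γ : V [⋀^Fin k]→ₗ[ℝ] ℝ) (w : Fin k → V) : γ w =
      ∑ f : Fin k → ι, (∏ j, inner ℝ (b (f j)) (w j)) * γ (fun j => b (f j)) := by
    rw [apply_eq_sum_prod_smul b.toBasis γ w]
    simp [OrthonormalBasis.repr_apply_apply]
  rw [formInner]
  congr 1
  set e := stdOrthonormalBasis ℝ V
  -- The sum over multi-indices factors into one sum per slot, and Parseval evaluates each factor.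
  have horth (f g : Fin k → ι) : ∑ i : Fin k → Fin (finrank ℝ V),
      (∏ j, inner ℝ (b (f j)) (e (i j))) * (∏ j, inner ℝ (b (g j)) (e (i j))) =
      if f = g then 1 else 0 := by
    simp only [← Finset.prod_mul_distrib]
    have hprod := Finset.prod_univ_sum (fun _ : Fin k => Finset.univ)
      (fun j i => inner ℝ (b (f j)) (e i) * inner ℝ (b (g j)) (e i))
    rw [Fintype.piFinset_univ] at hprod
    rw [← hprod]
    have : ∀ j, ∑ i, inner ℝ (b (f j)) (e i) * inner ℝ (b (g j)) (e i) =
        if f j = g j then (1 : ℝ) else 0 := by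
      intro j
      have := e.sum_inner_mul_inner (b (f j)) (b (g j))
      rw [← b.inner_eq_ite, ← this]
      exact Finset.sum_congr rfl fun i _ => by rw [real_inner_comm (b (g j))]
    simp only [this, Finset.prod_ite_zero, funext_iff]
    simp
  calc ∑ i : Fin k → Fin (finrank ℝ V), α (fun j => e (i j)) * β (fun j => e (i j))
      = ∑ i : Fin k → Fin (finrank ℝ V), ∑ f : Fin k → ι, ∑ g : Fin k → ι,
        ((∏ j, inner ℝ (b (f j)) (e (i j))) * (∏ j, inner ℝ (b (g j)) (e (i j)))) *
          (α (fun j => b (f j)) * β (fun j => b (g j))) := by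
        refine Finset.sum_congr rfl fun i _ => ?_
        rw [hexp α, hexp β, Finset.sum_mul_sum]
        exact Finset.sum_congr rfl fun f _ => Finset.sum_congr rfl fun g _ => by ring
    _ = ∑ f : Fin k → ι, ∑ g : Fin k → ι, (if f = g then 1 else 0) *
          (α (fun j => b (f j)) * β (fun j => b (g j))) := by
        rw [Finset.sum_comm]
        refine Finset.sum_congr rfl fun f _ => ?_
        rw [Finset.sum_comm]
        refine Finset.sum_congr rfl fun g _ => ?_
        rw [← Finset.sum_mul, horth]
    _ = _ := by simp

/-- An orthogonal complex structure as a linear isometry. -/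
def complexStructureIsometry (J : V →ₗ[ℝ] V) (hJ : ∀ v, J (J v) = -v)
    (hg : ∀ u v, inner ℝ (J u) (J v) = inner ℝ u v) : V ≃ₗᵢ[ℝ] V where
  toLinearEquiv := LinearEquiv.ofLinearMap J (-J) (by ext v; simp [hJ]) (by ext v; simp [hJ])
  norm_map' v := by
    have h := hg v v
    rw [real_inner_self_eq_norm_sq, real_inner_self_eq_norm_sq] at h
    exact (pow_left_inj₀ (norm_nonneg _) (norm_nonneg _) two_ne_zero).1 h

/-- J carries an orthonormal basis to an orthonormal basis, and `formInner` does not depend on that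
choice. -/
theorem formInner_compLinearMap (J : V →ₗ[ℝ] V) (hJ : ∀ v, J (J v) = -v)
    (hg : ∀ u v, inner ℝ (J u) (J v) = inner ℝ u v) (α β : V [⋀^Fin k]→ₗ[ℝ] ℝ) :
    formInner (α.compLinearMap J) (β.compLinearMap J) = formInner α β := by
  rw [formInner_eq_sum ((stdOrthonormalBasis ℝ V).map (complexStructureIsometry J hJ hg)) α β]
  rfl

/-- For the types `(3, 1)` and `(2, 0)`, the projection is `α ↦ (α - J^* α) / 2`. -/
theorem typeProj_eq (J : V →ₗ[ℝ] V) (hJ : ∀ v, J (J v) = -v)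
    (hg : ∀ u v, inner ℝ (J u) (J v) = inner ℝ u v) {p q : ℕ}
    (h : ∀ m ≤ p + q, Complex.I ^ m * (-Complex.I) ^ (p + q - m) = 1 ∨ m = p ∨ m = q)
    (hp : Complex.I ^ p * (-Complex.I) ^ q = -1) (hq : Complex.I ^ q * (-Complex.I) ^ p = -1)
    (α : V [⋀^Fin (p + q)]→ₗ[ℝ] ℝ) :
    typeProj J p q α = (2⁻¹ : ℝ) • (α - α.compLinearMap J) := by
  set S := realFormsOfType J p q with hS
  set P := (2⁻¹ : ℝ) • (α - α.compLinearMap J) with hP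
  -- By `hp` and `hq`, J^* is -1 on both types that make up `S`.
  have hneg : ∀ β ∈ S, β.compLinearMap J = -β := by
    intro β hβ
    have hβ' : ofRealForm β ∈ formsOfType J (p + q) p ⊔ formsOfType J (p + q) q := hβ
    obtain ⟨γ, hγ, δ, hδ, he⟩ := Submodule.mem_sup.1 hβ'
    have h1 := compLinearMap_of_mem_formsOfType J (Nat.le_add_right p q) hγ
    have h2 := compLinearMap_of_mem_formsOfType J (Nat.le_add_left q p) hδ
    rw [Nat.add_sub_cancel_left, hp] at h1
    rw [Nat.add_sub_cancel, hq] at h2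
    ext v
    have h3 := congrArg (fun f => f v) h1
    have h4 := congrArg (fun f => f v) h2
    have h5 := congrArg (fun f => f v) he
    have h6 := congrArg (fun f => f (J ∘ v)) he
    simp only [AlternatingMap.compLinearMap_apply, AlternatingMap.smul_apply,
      AlternatingMap.add_apply, ofRealForm, LinearMap.compAlternatingMap_apply, smul_eq_mul,
      Function.comp_def] at h3 h4 h5 h6
    rw [h3, h4] at h6
    have h7 : ((β fun i => J (v i) : ℝ) : ℂ) = ((-β v : ℝ) : ℂ) := by
      refine h6.symm.trans ?_
      rw [Complex.ofReal_neg]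
      refine Eq.trans ?_ (congrArg Neg.neg h5)
      ring
    exact Complex.ofReal_injective h7
  have hPmem : P ∈ S := by
    have h1 := Submodule.smul_mem _ (2⁻¹ : ℂ) (sub_compLinearMap_mem hJ h (ofRealForm α))
    have h2 : ofRealForm P = (2⁻¹ : ℂ) • (ofRealForm α - (ofRealForm α).compLinearMap J) := by
      ext v
      simp [ofRealForm, hP]
    change ofRealForm P ∈ formsOfType J (p + q) p ⊔ formsOfType J (p + q) q
    rwa [h2]
  -- The remainder α - P = (α + J^* α) / 2 is J^*-invariant, whereas β is anti-invariant. Since J^*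
  -- is an isometry, they are orthogonal.
  have hPorth : ∀ β ∈ S, formInner (α - P) β = 0 := by
    intro β hβ
    have h1 := formInner_compLinearMap J hJ hg α β
    rw [hneg β hβ] at h1
    have e : α - P = (2⁻¹ : ℝ) • (α + α.compLinearMap J) := by
      ext v
      simp [hP]
      ring
    have h2 := (formCore V (p + q)).smul_left (α + α.compLinearMap J) β 2⁻¹
    have h3 := (formCore V (p + q)).add_left α (α.compLinearMap J) β
    have h4 := (formCore V (p + q)).smul_left β (α.compLinearMap J) (-1)
    have h5 := (formCore V (p + q)).conj_inner_symm (α.compLinearMap J) β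
    have h6 := (formCore V (p + q)).conj_inner_symm (α.compLinearMap J) (-β)
    simp only [conj_trivial, neg_one_smul] at h2 h3 h4 h5 h6
    change formInner _ _ = _ * formInner _ _ at h2
    change formInner _ _ = formInner _ _ + formInner _ _ at h3
    change formInner _ _ = _ * formInner _ _ at h4
    change formInner _ _ = formInner _ _ at h5
    change formInner _ _ = formInner _ _ at h6
    rw [e, h2, h3]
    linarith
  obtain ⟨h1, h2⟩ := orthProj_spec S α
  -- The difference of two candidates lies in `S` and is orthogonal to `S`, hence to itself.
  have hsub : formInner (P - orthProj S α) (P - orthProj S α) = 0 := by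
    have hm := S.sub_mem hPmem h1
    have h3 := h2 _ hm
    have h4 := hPorth _ hm
    have h5 := (formCore V (p + q)).add_left (α - P) (P - orthProj S α) (P - orthProj S α)
    rw [sub_add_sub_cancel] at h5
    change formInner _ _ = formInner _ _ + formInner _ _ at h5
    linarith
  exact (sub_eq_zero.1 ((formCore V (p + q)).definite _ hsub)).symm

/-- On type (m, 4 - m), J^* is the scalar (-1)^m, so the anti-invariant types are exactly (3, 1) and
(1, 3). -/
theorem typeProj_three_one (J : V →ₗ[ℝ] V) (hJ : ∀ v, J (J v) = -v)
    (hg : ∀ u v, inner ℝ (J u) (J v) = inner ℝ u v) (α : V [⋀^Fin 4]→ₗ[ℝ] ℝ) :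
    typeProj J 3 1 α = (2⁻¹ : ℝ) • (α - α.compLinearMap J) := by
  refine typeProj_eq (p := 3) (q := 1) J hJ hg (fun m hm => ?_) ?_ ?_ α
  · interval_cases m <;> simp [pow_succ]
  · simp [pow_succ]
  · simp [pow_succ]

/-- On type (m, 2 - m), J^* is the scalar (-1)^(m - 1), so only (1, 1) is invariant. -/
theorem typeProj_two_zero (J : V →ₗ[ℝ] V) (hJ : ∀ v, J (J v) = -v)
    (hg : ∀ u v, inner ℝ (J u) (J v) = inner ℝ u v) (α : V [⋀^Fin 2]→ₗ[ℝ] ℝ) :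
    typeProj J 2 0 α = (2⁻¹ : ℝ) • (α - α.compLinearMap J) := by
  refine typeProj_eq (p := 2) (q := 0) J hJ hg (fun m hm => ?_) ?_ ?_ α
  · interval_cases m <;> simp
  · simp
  · simp

end Projection

/-! ### Orthonormal bases adapted to J -/

section AdaptedBasis

variable {V : Type*} [NormedAddCommGroup V] [InnerProductSpace ℝ V]

theorem exists_unit_orthogonal (s : Finset V) (hs : s.card < finrank ℝ V) :
    ∃ v : V, ‖v‖ = 1 ∧ ∀ u ∈ s, inner ℝ u v = 0 := by
  have h1 : finrank ℝ (Submodule.span ℝ (s : Set V)) < finrank ℝ V :=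
    (finrank_span_finset_le_card s).trans_lt hs
  have h2 : (Submodule.span ℝ (s : Set V))ᗮ ≠ ⊥ := by
    intro h
    rw [Submodule.orthogonal_eq_bot_iff] at h
    rw [h, finrank_top] at h1
    exact lt_irrefl _ h1
  obtain ⟨v, hv, hv0⟩ := Submodule.exists_mem_ne_zero_of_ne_bot h2
  have hn : ‖v‖ ≠ 0 := norm_ne_zero_iff.2 hv0
  refine ⟨‖v‖⁻¹ • v, by rw [norm_smul, norm_inv, norm_norm, inv_mul_cancel₀ hn], fun u hu => ?_⟩
  rw [inner_smul_right, (Submodule.mem_orthogonal _ v).1 hv u (Submodule.subset_span hu), mul_zero]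

/-- A Euclidean space of dimension 6 with an orthogonal complex structure has an orthonormal basis
of the form `e₁, J e₁, e₂, J e₂, e₃, J e₃`. -/
theorem exists_adapted_basis (hV : finrank ℝ V = 6) (J : V →ₗ[ℝ] V) (hJ : ∀ v, J (J v) = -v)
    (hg : ∀ u v, inner ℝ (J u) (J v) = inner ℝ u v) :
    ∃ b : OrthonormalBasis (Fin 6) ℝ V, J (b 0) = b 1 ∧ J (b 2) = b 3 ∧ J (b 4) = b 5 := by
  classical
  -- J is skew, so a vector orthogonal to x and J x has its J-image orthogonal to both as well. Only
  -- x, y and z have to be chosen.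
  have hskew (u v : V) : inner ℝ u (J v) = -inner ℝ (J u) v := by
    rw [← hg u (J v), hJ, inner_neg_right]
  have hself (u : V) : inner ℝ u (J u) = 0 := by
    have := hskew u u
    rw [real_inner_comm u (J u)] at this
    linarith
  have hself' (u : V) : inner ℝ (J u) u = 0 := by rw [real_inner_comm, hself]
  obtain ⟨x, hx, -⟩ := exists_unit_orthogonal (∅ : Finset V) (by rw [hV]; simp)
  obtain ⟨y, hy, hy'⟩ := exists_unit_orthogonal ({x, J x} : Finset V)
    (by rw [hV]; exact Finset.card_le_two.trans_lt (by norm_num))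
  obtain ⟨z, hz, hz'⟩ := exists_unit_orthogonal ({x, J x, y, J y} : Finset V)
    (by rw [hV]; exact Finset.card_le_four.trans_lt (by norm_num))
  simp only [Finset.mem_insert, Finset.mem_singleton, forall_eq_or_imp, forall_eq] at hy' hz'
  obtain ⟨hxy, hJxy⟩ := hy'
  obtain ⟨hxz, hJxz, hyz, hJyz⟩ := hz'
  have hyx : inner ℝ y x = 0 := by rw [real_inner_comm, hxy]
  have hzx : inner ℝ z x = 0 := by rw [real_inner_comm, hxz]
  have hzy : inner ℝ z y = 0 := by rw [real_inner_comm, hyz]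
  have hyJx : inner ℝ y (J x) = 0 := by rw [real_inner_comm, hJxy]
  have hzJx : inner ℝ z (J x) = 0 := by rw [real_inner_comm, hJxz]
  have hzJy : inner ℝ z (J y) = 0 := by rw [real_inner_comm, hJyz]
  have hxJy : inner ℝ x (J y) = 0 := by rw [hskew, hJxy, neg_zero]
  have hxJz : inner ℝ x (J z) = 0 := by rw [hskew, hJxz, neg_zero]
  have hyJz : inner ℝ y (J z) = 0 := by rw [hskew, hJyz, neg_zero]
  have hJyx : inner ℝ (J y) x = 0 := by rw [real_inner_comm, hxJy]
  have hJzx : inner ℝ (J z) x = 0 := by rw [real_inner_comm, hxJz]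
  have hJzy : inner ℝ (J z) y = 0 := by rw [real_inner_comm, hyJz]
  have hxx : inner ℝ x x = (1 : ℝ) := by rw [real_inner_self_eq_norm_sq, hx, one_pow]
  have hyy : inner ℝ y y = (1 : ℝ) := by rw [real_inner_self_eq_norm_sq, hy, one_pow]
  have hzz : inner ℝ z z = (1 : ℝ) := by rw [real_inner_self_eq_norm_sq, hz, one_pow]
  have hJn (u : V) : ‖J u‖ = ‖u‖ := (complexStructureIsometry J hJ hg).norm_map u
  have hon : Orthonormal ℝ ![x, J x, y, J y, z, J z] := by
    rw [orthonormal_iff_ite]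
    intro i j
    fin_cases i <;> fin_cases j <;> simp [*]
  have hb : ∃ b : OrthonormalBasis (Fin 6) ℝ V, ⇑b = ![x, J x, y, J y, z, J z] :=
    ⟨(basisOfOrthonormalOfCardEqFinrank hon (by simp [hV])).toOrthonormalBasis (by simpa using hon),
      by simp⟩
  obtain ⟨b, hb⟩ := hb
  exact ⟨b, by simp [hb], by simp [hb], by simp [hb]⟩

end AdaptedBasis

/-! ### Norms of forms via increasing multi-indices -/

section Coordinates

/-- A symmetric sum over injective index functions is a multiple of the sum over increasing ones. -/
theorem sum_eq_factorial_mul_sum_strictMono {k n : ℕ} (φ : (Fin k → Fin n) → ℝ)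
    (hperm : ∀ f (σ : Equiv.Perm (Fin k)), φ (f ∘ σ) = φ f)
    (hinj : ∀ f, ¬ Function.Injective f → φ f = 0)
    (S : Finset (Fin k → Fin n)) (hS : ∀ f, f ∈ S ↔ StrictMono f) :
    ∑ f, φ f = k.factorial * ∑ f ∈ S, φ f := by
  classical
  have h1 : ∑ f, φ f = ∑ x ∈ S ×ˢ (Finset.univ : Finset (Equiv.Perm (Fin k))), φ (x.1 ∘ x.2) := by
    rw [← Finset.sum_filter_of_ne (p := Function.Injective)
      (fun f _ hf => by by_contra h; exact hf (hinj f h))]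
    symm
    refine Finset.sum_nbij (fun x => x.1 ∘ x.2) ?_ ?_ ?_ (fun _ _ => rfl)
    · rintro ⟨g, σ⟩ h
      simp only [Finset.mem_product, hS, Finset.mem_univ, and_true] at h
      simpa using h.injective
    · rintro ⟨g, σ⟩ h ⟨g', σ'⟩ h' he
      simp only [Finset.coe_product, Set.mem_prod, Finset.mem_coe, hS] at h h'
      have he' : g ∘ σ = g' ∘ σ' := he
      have hr : Set.range g = Set.range g' := by
        rw [← σ.surjective.range_comp g, he', σ'.surjective.range_comp]
      have hg : g = g' := (h.1.range_inj h'.1).1 hr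
      subst hg
      have : σ = σ' := Equiv.ext fun i => h.1.injective (congrFun he' i)
      rw [this]
    · intro f hf
      have hf' : Function.Injective f := by simpa using hf
      -- Sorting an injective index function makes it strictly increasing; the inverse of the
      -- sorting permutation recovers the original.
      refine ⟨(f ∘ Tuple.sort f, (Tuple.sort f)⁻¹), ?_, ?_⟩
      · simp only [Finset.coe_product, Set.mem_prod, Finset.mem_coe, hS, Finset.mem_univ, and_true]
        exact (Tuple.monotone_sort f).strictMono_of_injective
          (hf'.comp (Tuple.sort f).injective)
      · funext i
        simp
  rw [h1, Finset.sum_product, Finset.mul_sum]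
  refine Finset.sum_congr rfl fun f _ => ?_
  simp [hperm, Fintype.card_perm]

variable {V : Type*} [NormedAddCommGroup V] [InnerProductSpace ℝ V] [FiniteDimensional ℝ V] {k : ℕ}

/-- In the product of two alternating forms the permutation signs square to 1, so each increasing
multi-index is counted k! times. `S` is left free so that an explicit list can be supplied. -/
theorem formInner_eq_sum_strictMono {n : ℕ} (b : OrthonormalBasis (Fin n) ℝ V)
    (α β : V [⋀^Fin k]→ₗ[ℝ] ℝ) (S : Finset (Fin k → Fin n)) (hS : ∀ f, f ∈ S ↔ StrictMono f) :
    formInner α β = ∑ f ∈ S, α (fun j => b (f j)) * β (fun j => b (f j)) := by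
  have hk : (k.factorial : ℝ) ≠ 0 := Nat.cast_ne_zero.2 k.factorial_ne_zero
  rw [formInner_eq_sum b, sum_eq_factorial_mul_sum_strictMono _ _ _ S hS, ← mul_assoc,
    inv_mul_cancel₀ hk, one_mul]
  · intro f σ
    have h1 := α.map_perm (fun j => b (f j)) σ
    have h2 := β.map_perm (fun j => b (f j)) σ
    simp only [Function.comp_def] at h1 h2 ⊢
    rw [h1, h2, smul_mul_smul_comm, Int.units_mul_self, one_smul]
  · intro f hf
    have : α (fun j => b (f j)) = 0 := by
      refine α.map_eq_zero_of_not_injective _ fun h => hf ?_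
      exact Function.Injective.of_comp (f := b) h
    rw [this, zero_mul]

/-- The identity is the only strictly increasing self-map of `Fin n`, so a single coefficient
survives. -/
theorem formInner_top {n : ℕ} (b : OrthonormalBasis (Fin n) ℝ V) (α β : V [⋀^Fin n]→ₗ[ℝ] ℝ) :
    formInner α β = α b * β b := by
  rw [formInner_eq_sum_strictMono b α β {id}]
  · simp
  · intro f
    rw [Finset.mem_singleton]
    refine ⟨fun h => h ▸ strictMono_id, fun h => ?_⟩
    refine (h.range_inj strictMono_id).1 ?_
    rw [Set.range_id, (Finite.surjective_of_injective h.injective).range_eq]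

/-- The increasing index quadruples. -/
def quadruples : Finset (Fin 4 → Fin 6) :=
  {![0, 1, 2, 3], ![0, 1, 2, 4], ![0, 1, 2, 5], ![0, 1, 3, 4], ![0, 1, 3, 5], ![0, 1, 4, 5],
    ![0, 2, 3, 4], ![0, 2, 3, 5], ![0, 2, 4, 5], ![0, 3, 4, 5], ![1, 2, 3, 4], ![1, 2, 3, 5],
    ![1, 2, 4, 5], ![1, 3, 4, 5], ![2, 3, 4, 5]}

theorem mem_quadruples (f : Fin 4 → Fin 6) : f ∈ quadruples ↔ StrictMono f := by
  rw [Fin.strictMono_iff_lt_succ]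
  revert f
  decide +kernel

theorem sum_quadruples (φ : (Fin 4 → Fin 6) → ℝ) : ∑ f ∈ quadruples, φ f =
    φ ![0, 1, 2, 3] + φ ![0, 1, 2, 4] + φ ![0, 1, 2, 5] + φ ![0, 1, 3, 4] + φ ![0, 1, 3, 5]
    + φ ![0, 1, 4, 5] + φ ![0, 2, 3, 4] + φ ![0, 2, 3, 5] + φ ![0, 2, 4, 5] + φ ![0, 3, 4, 5]
    + φ ![1, 2, 3, 4] + φ ![1, 2, 3, 5] + φ ![1, 2, 4, 5] + φ ![1, 3, 4, 5] + φ ![2, 3, 4, 5] := by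
  rw [quadruples]
  repeat rw [Finset.sum_insert (by decide)]
  rw [Finset.sum_singleton]
  ring

theorem formNorm_sq_real (α : V [⋀^Fin k]→ₗ[ℝ] ℝ) : formNorm α ^ 2 = formInner α α := by
  rw [formNorm, Real.sq_sqrt (by positivity), formInner]
  simp [pow_two]

theorem formNorm_sq_complex (α : V [⋀^Fin k]→ₗ[ℝ] ℂ) :
    formNorm α ^ 2 = formNorm (reForm α) ^ 2 + formNorm (imForm α) ^ 2 := by
  rw [formNorm_sq_real, formNorm_sq_real, formNorm, Real.sq_sqrt (by positivity), formInner,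
    formInner, ← mul_add, ← Finset.sum_add_distrib]
  congr 1
  refine Finset.sum_congr rfl fun i _ => ?_
  rw [Complex.sq_norm, Complex.normSq_apply]
  rfl

end Coordinates

/-! ### Powers of 2-forms and the determinant through Pfaffians -/

section Wedge

variable {V : Type*} [AddCommGroup V] [Module ℝ V] {W : Type*} [AddCommGroup W] [Module ℝ W]

theorem twoForm_swap (α : V [⋀^Fin 2]→ₗ[ℝ] W) (u v : V) : α ![v, u] = -α ![u, v] := by
  have h := α.map_swap ![u, v] (i := 0) (j := 1) (by simp)
  rw [← h]
  congr 1
  funext l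
  fin_cases l <;> simp

variable [FiniteDimensional ℝ V]

/-- The bracket is the 4 × 4 Pfaffian: the twelve Laplace terms give each of its three summands four
times, against the factor 2 on the left. -/
theorem wedgeSq_apply (α : V [⋀^Fin 2]→ₗ[ℝ] ℂ) (v : Fin 4 → V) :
    wedgeSq α v = 2 * (α ![v 0, v 1] * α ![v 2, v 3] - α ![v 0, v 2] * α ![v 1, v 3]
      + α ![v 0, v 3] * α ![v 1, v 2]) := by
  have h : 2 * wedge α α v = ∑ i : Fin 4, ∑ j : Fin 3,
      (-1) ^ (i + j : ℕ) * α ![v i, v (i.succAbove j)] *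
        α (fun l => v (i.succAbove (j.succAbove l))) := two_mul_wedge_two_apply α α v
  have e (i : Fin 4) (j : Fin 3) : α (fun l => v (i.succAbove (j.succAbove l))) =
      α ![v (i.succAbove (j.succAbove 0)), v (i.succAbove (j.succAbove 1))] := by
    congr 1
    funext l
    fin_cases l <;> rfl
  have h' (i j : Fin 4) : α ![v j, v i] = -α ![v i, v j] := twoForm_swap α _ _
  simp only [Fin.sum_univ_four, Fin.sum_univ_three, e] at h
  simp [Fin.succAbove, h' 0 1, h' 0 2, h' 0 3, h' 1 2, h' 1 3, h' 2 3] at h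
  rw [wedgeSq]
  linear_combination h / 2

/-- Up to 3!, this is the 6 × 6 Pfaffian expanded along its first row. -/
theorem wedgeCube_apply (α : V [⋀^Fin 2]→ₗ[ℝ] ℂ) (v : Fin 6 → V) :
    wedgeCube α v = 6 * (
      α ![v 0, v 1] * (α ![v 2, v 3] * α ![v 4, v 5] - α ![v 2, v 4] * α ![v 3, v 5]
        + α ![v 2, v 5] * α ![v 3, v 4])
      - α ![v 0, v 2] * (α ![v 1, v 3] * α ![v 4, v 5] - α ![v 1, v 4] * α ![v 3, v 5]
        + α ![v 1, v 5] * α ![v 3, v 4])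
      + α ![v 0, v 3] * (α ![v 1, v 2] * α ![v 4, v 5] - α ![v 1, v 4] * α ![v 2, v 5]
        + α ![v 1, v 5] * α ![v 2, v 4])
      - α ![v 0, v 4] * (α ![v 1, v 2] * α ![v 3, v 5] - α ![v 1, v 3] * α ![v 2, v 5]
        + α ![v 1, v 5] * α ![v 2, v 3])
      + α ![v 0, v 5] * (α ![v 1, v 2] * α ![v 3, v 4] - α ![v 1, v 3] * α ![v 2, v 4]
        + α ![v 1, v 4] * α ![v 2, v 3])) := by
  have h : 2 * wedge (wedgeSq α) α v = ∑ i : Fin 6, ∑ j : Fin 5,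
      (-1) ^ (i + j : ℕ) * α ![v i, v (i.succAbove j)] *
        wedgeSq α (fun l => v (i.succAbove (j.succAbove l))) :=
    two_mul_wedge_two_apply (wedgeSq α) α v
  have h' (i j : Fin 6) : α ![v j, v i] = -α ![v i, v j] := twoForm_swap α _ _
  simp only [Fin.sum_univ_six, Fin.sum_univ_five, wedgeSq_apply] at h
  simp [Fin.succAbove, h' 0 1, h' 0 2, h' 0 3, h' 0 4, h' 0 5, h' 1 2, h' 1 3, h' 1 4, h' 1 5,
    h' 2 3, h' 2 4, h' 2 5, h' 3 4, h' 3 5, h' 4 5] at h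
  rw [wedgeCube]
  linear_combination h / 2

end Wedge

/-- det (1 + A) is the sum of the principal minors of A. For skew A the odd ones vanish and the even
ones are squares of Pfaffians, of sizes 0, 2, 4 and 6 here. -/
theorem det_one_add_skew (a01 a02 a03 a04 a05 a12 a13 a14 a15 a23 a24 a25 a34 a35 a45 : ℝ) :
    !![1, a01, a02, a03, a04, a05;
      -a01, 1, a12, a13, a14, a15;
      -a02, -a12, 1, a23, a24, a25;
      -a03, -a13, -a23, 1, a34, a35;
      -a04, -a14, -a24, -a34, 1, a45;
      -a05, -a15, -a25, -a35, -a45, 1].det =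
    1 + (a01 ^ 2 + a02 ^ 2 + a03 ^ 2 + a04 ^ 2 + a05 ^ 2 + a12 ^ 2 + a13 ^ 2 + a14 ^ 2 + a15 ^ 2
        + a23 ^ 2 + a24 ^ 2 + a25 ^ 2 + a34 ^ 2 + a35 ^ 2 + a45 ^ 2)
      + ((a01 * a23 - a02 * a13 + a03 * a12) ^ 2 + (a01 * a24 - a02 * a14 + a04 * a12) ^ 2
        + (a01 * a25 - a02 * a15 + a05 * a12) ^ 2 + (a01 * a34 - a03 * a14 + a04 * a13) ^ 2
        + (a01 * a35 - a03 * a15 + a05 * a13) ^ 2 + (a01 * a45 - a04 * a15 + a05 * a14) ^ 2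
        + (a02 * a34 - a03 * a24 + a04 * a23) ^ 2 + (a02 * a35 - a03 * a25 + a05 * a23) ^ 2
        + (a02 * a45 - a04 * a25 + a05 * a24) ^ 2 + (a03 * a45 - a04 * a35 + a05 * a34) ^ 2
        + (a12 * a34 - a13 * a24 + a14 * a23) ^ 2 + (a12 * a35 - a13 * a25 + a15 * a23) ^ 2
        + (a12 * a45 - a14 * a25 + a15 * a24) ^ 2 + (a13 * a45 - a14 * a35 + a15 * a34) ^ 2
        + (a23 * a45 - a24 * a35 + a25 * a34) ^ 2)
      + (a01 * (a23 * a45 - a24 * a35 + a25 * a34) - a02 * (a13 * a45 - a14 * a35 + a15 * a34)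
        + a03 * (a12 * a45 - a14 * a25 + a15 * a24) - a04 * (a12 * a35 - a13 * a25 + a15 * a23)
        + a05 * (a12 * a34 - a13 * a24 + a14 * a23)) ^ 2 := by
  rw [Matrix.det_succ_row_zero, Fin.sum_univ_six]
  simp [Matrix.det_succ_row_zero, Fin.sum_univ_five, Fin.sum_univ_four, Fin.sum_univ_three,
    Fin.succAbove]
  ring

/-! ### The pointwise identity in real dimension six -/

section DimensionThree

variable {V : Type*} [NormedAddCommGroup V] [InnerProductSpace ℝ V]

theorem twoForm_neg_left (a : V [⋀^Fin 2]→ₗ[ℝ] ℝ) (u v : V) : a ![-u, v] = -a ![u, v] :=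
  congrArg (fun f => f v) ((bilinOfTwoForm a).map_neg u)

theorem twoForm_neg_right (a : V [⋀^Fin 2]→ₗ[ℝ] ℝ) (u v : V) : a ![u, -v] = -a ![u, v] :=
  (bilinOfTwoForm a u).map_neg v

/-- The complex-valued 2-form `ω + i a`. -/
def complexifiedForm (J : V →ₗ[ℝ] V) (hJ : ∀ v, J (J v) = -v)
    (hg : ∀ u v, inner ℝ (J u) (J v) = inner ℝ u v) (a : V [⋀^Fin 2]→ₗ[ℝ] ℝ) :
    V [⋀^Fin 2]→ₗ[ℝ] ℂ :=
  ofRealForm (fundamentalForm J hJ hg) + Complex.I • ofRealForm a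

theorem complexifiedForm_apply {J : V →ₗ[ℝ] V} {hJ : ∀ v, J (J v) = -v}
    {hg : ∀ u v, inner ℝ (J u) (J v) = inner ℝ u v} {a : V [⋀^Fin 2]→ₗ[ℝ] ℝ} (v : Fin 2 → V) :
    complexifiedForm J hJ hg a v = (fundamentalForm J hJ hg v : ℂ) + Complex.I * a v := rfl

variable [FiniteDimensional ℝ V]

theorem typeProj_three_one_apply (J : V →ₗ[ℝ] V) (hJ : ∀ v, J (J v) = -v)
    (hg : ∀ u v, inner ℝ (J u) (J v) = inner ℝ u v) (α : V [⋀^Fin 4]→ₗ[ℝ] ℝ) (v : Fin 4 → V) :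
    typeProj J 3 1 α v = 2⁻¹ * (α v - α fun i => J (v i)) := by
  rw [typeProj_three_one J hJ hg]
  rfl

theorem typeProj_two_zero_apply (J : V →ₗ[ℝ] V) (hJ : ∀ v, J (J v) = -v)
    (hg : ∀ u v, inner ℝ (J u) (J v) = inner ℝ u v) (α : V [⋀^Fin 2]→ₗ[ℝ] ℝ) (v : Fin 2 → V) :
    typeProj J 2 0 α v = 2⁻¹ * (α v - α fun i => J (v i)) := by
  rw [typeProj_two_zero J hJ hg]
  rfl

theorem reForm_typeProjC (J : V →ₗ[ℝ] V) (p q : ℕ) (α : V [⋀^Fin (p + q)]→ₗ[ℝ] ℂ) :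
    reForm (typeProjC J p q α) = typeProj J p q (reForm α) := by
  ext v
  simp [reForm, typeProjC, ofRealForm]

theorem imForm_typeProjC (J : V →ₗ[ℝ] V) (p q : ℕ) (α : V [⋀^Fin (p + q)]→ₗ[ℝ] ℂ) :
    imForm (typeProjC J p q α) = typeProj J p q (imForm α) := by
  ext v
  simp [imForm, typeProjC, ofRealForm]

variable {J : V →ₗ[ℝ] V} {hJ : ∀ v, J (J v) = -v}
  {hg : ∀ u v, inner ℝ (J u) (J v) = inner ℝ u v} {a : V [⋀^Fin 2]→ₗ[ℝ] ℝ}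

/-- (ω + i a)² / 2 = (ω² - a²) / 2 + i ω ∧ a; this is the real part, evaluated. -/
theorem reForm_square_apply (v : Fin 4 → V) :
    reForm (((Nat.factorial 2 : ℂ))⁻¹ • wedgeSq (complexifiedForm J hJ hg a)) v =
      inner ℝ (J (v 0)) (v 1) * inner ℝ (J (v 2)) (v 3)
      - inner ℝ (J (v 0)) (v 2) * inner ℝ (J (v 1)) (v 3)
      + inner ℝ (J (v 0)) (v 3) * inner ℝ (J (v 1)) (v 2)
      - (a ![v 0, v 1] * a ![v 2, v 3] - a ![v 0, v 2] * a ![v 1, v 3]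
        + a ![v 0, v 3] * a ![v 1, v 2]) := by
  simp [reForm, wedgeSq_apply, complexifiedForm_apply, fundamentalForm_apply]
  ring

theorem imForm_square_apply (v : Fin 4 → V) :
    imForm (((Nat.factorial 2 : ℂ))⁻¹ • wedgeSq (complexifiedForm J hJ hg a)) v =
      inner ℝ (J (v 0)) (v 1) * a ![v 2, v 3] + a ![v 0, v 1] * inner ℝ (J (v 2)) (v 3)
      - (inner ℝ (J (v 0)) (v 2) * a ![v 1, v 3] + a ![v 0, v 2] * inner ℝ (J (v 1)) (v 3))
      + (inner ℝ (J (v 0)) (v 3) * a ![v 1, v 2] + a ![v 0, v 3] * inner ℝ (J (v 1)) (v 2)) := by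
  simp [imForm, wedgeSq_apply, complexifiedForm_apply, fundamentalForm_apply]

/-- The matrix of a^♯ in an orthonormal basis is the transpose of (a(bᵢ, bⱼ)), and transposition
preserves the determinant. -/
theorem det_id_add_sharp (b : OrthonormalBasis (Fin 6) ℝ V) (a : V [⋀^Fin 2]→ₗ[ℝ] ℝ) :
    LinearMap.det (LinearMap.id + sharp a) =
      (1 + Matrix.of fun i j => a ![b i, b j]).det := by
  rw [← LinearMap.det_toMatrix b.toBasis, ← Matrix.det_transpose]
  congr 1
  ext i j
  rw [Matrix.transpose_apply, LinearMap.toMatrix_apply]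
  simp only [OrthonormalBasis.coe_toBasis, OrthonormalBasis.coe_toBasis_repr_apply,
    OrthonormalBasis.repr_apply_apply, LinearMap.add_apply, LinearMap.id_apply, inner_add_right,
    Matrix.add_apply, Matrix.of_apply, b.inner_eq_ite, Matrix.one_apply]
  rw [real_inner_comm, inner_sharp]
  simp only [eq_comm]

/-- Each square is a difference a(bᵢ, bⱼ) - a(J bᵢ, J bⱼ). The right side therefore vanishes only
for J-invariant a, which is the injectivity of ω ∧ · on ⟦Λ^{2,0}⟧ in coordinates. -/
theorem formInner_typeProj_imForm_square {b : OrthonormalBasis (Fin 6) ℝ V} (h0 : J (b 0) = b 1)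
    (h2 : J (b 2) = b 3) (h4 : J (b 4) = b 5) :
    formInner (typeProj J 3 1 (imForm
        (((Nat.factorial 2 : ℂ))⁻¹ • wedgeSq (complexifiedForm J hJ hg a))))
      (typeProj J 3 1 (imForm
        (((Nat.factorial 2 : ℂ))⁻¹ • wedgeSq (complexifiedForm J hJ hg a)))) =
    2⁻¹ * ((a ![b 0, b 2] - a ![b 1, b 3]) ^ 2 + (a ![b 0, b 3] + a ![b 1, b 2]) ^ 2
      + (a ![b 0, b 4] - a ![b 1, b 5]) ^ 2 + (a ![b 0, b 5] + a ![b 1, b 4]) ^ 2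
      + (a ![b 2, b 4] - a ![b 3, b 5]) ^ 2 + (a ![b 2, b 5] + a ![b 3, b 4]) ^ 2) := by
  have h1 : J (b 1) = -b 0 := by rw [← h0, hJ]
  have h3 : J (b 3) = -b 2 := by rw [← h2, hJ]
  have h5 : J (b 5) = -b 4 := by rw [← h4, hJ]
  -- The three quadruples made of two J-pairs drop out under 1 - J^*. J exchanges the other twelve
  -- in pairs up to sign, so each square occurs twice with weight 1/4.
  rw [formInner_eq_sum_strictMono b _ _ quadruples mem_quadruples, sum_quadruples]
  simp only [typeProj_three_one_apply J hJ hg, imForm_square_apply, Matrix.cons_val, h0, h1, h2, h3,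
    h4, h5, twoForm_neg_left, twoForm_neg_right, b.inner_eq_ite, map_neg,
    inner_neg_left, inner_neg_right, neg_neg, Fin.isValue,
    Fin.reduceEq, reduceIte, twoForm_swap a (b 0) (b 1), twoForm_swap a (b 2) (b 3),
    twoForm_swap a (b 4) (b 5)]
  generalize a ![b 0, b 1] = a01
  generalize a ![b 0, b 2] = a02
  generalize a ![b 0, b 3] = a03
  generalize a ![b 0, b 4] = a04
  generalize a ![b 0, b 5] = a05
  generalize a ![b 1, b 2] = a12
  generalize a ![b 1, b 3] = a13
  generalize a ![b 1, b 4] = a14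
  generalize a ![b 1, b 5] = a15
  generalize a ![b 2, b 3] = a23
  generalize a ![b 2, b 4] = a24
  generalize a ![b 2, b 5] = a25
  generalize a ![b 3, b 4] = a34
  generalize a ![b 3, b 5] = a35
  generalize a ![b 4, b 5] = a45
  ring

/-- ω² is J-invariant, so only -a² / 2 contributes, through differences of 4 × 4 Pfaffians related
by J. -/
theorem formInner_typeProj_reForm_square {b : OrthonormalBasis (Fin 6) ℝ V} (h0 : J (b 0) = b 1)
    (h2 : J (b 2) = b 3) (h4 : J (b 4) = b 5) :
    formInner (typeProj J 3 1 (reForm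
        (((Nat.factorial 2 : ℂ))⁻¹ • wedgeSq (complexifiedForm J hJ hg a))))
      (typeProj J 3 1 (reForm
        (((Nat.factorial 2 : ℂ))⁻¹ • wedgeSq (complexifiedForm J hJ hg a)))) =
    2⁻¹ * (((a ![b 0, b 1] * a ![b 2, b 4] - a ![b 0, b 2] * a ![b 1, b 4]
        + a ![b 0, b 4] * a ![b 1, b 2])
        - (a ![b 0, b 1] * a ![b 3, b 5] - a ![b 0, b 3] * a ![b 1, b 5]
        + a ![b 0, b 5] * a ![b 1, b 3])) ^ 2
      + ((a ![b 0, b 1] * a ![b 2, b 5] - a ![b 0, b 2] * a ![b 1, b 5]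
        + a ![b 0, b 5] * a ![b 1, b 2])
        + (a ![b 0, b 1] * a ![b 3, b 4] - a ![b 0, b 3] * a ![b 1, b 4]
        + a ![b 0, b 4] * a ![b 1, b 3])) ^ 2
      + ((a ![b 0, b 2] * a ![b 3, b 4] - a ![b 0, b 3] * a ![b 2, b 4]
        + a ![b 0, b 4] * a ![b 2, b 3])
        - (a ![b 1, b 2] * a ![b 3, b 5] - a ![b 1, b 3] * a ![b 2, b 5]
        + a ![b 1, b 5] * a ![b 2, b 3])) ^ 2
      + ((a ![b 0, b 2] * a ![b 3, b 5] - a ![b 0, b 3] * a ![b 2, b 5]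
        + a ![b 0, b 5] * a ![b 2, b 3])
        + (a ![b 1, b 2] * a ![b 3, b 4] - a ![b 1, b 3] * a ![b 2, b 4]
        + a ![b 1, b 4] * a ![b 2, b 3])) ^ 2
      + ((a ![b 0, b 2] * a ![b 4, b 5] - a ![b 0, b 4] * a ![b 2, b 5]
        + a ![b 0, b 5] * a ![b 2, b 4])
        - (a ![b 1, b 3] * a ![b 4, b 5] - a ![b 1, b 4] * a ![b 3, b 5]
        + a ![b 1, b 5] * a ![b 3, b 4])) ^ 2
      + ((a ![b 0, b 3] * a ![b 4, b 5] - a ![b 0, b 4] * a ![b 3, b 5]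
        + a ![b 0, b 5] * a ![b 3, b 4])
        + (a ![b 1, b 2] * a ![b 4, b 5] - a ![b 1, b 4] * a ![b 2, b 5]
        + a ![b 1, b 5] * a ![b 2, b 4])) ^ 2) := by
  have h1 : J (b 1) = -b 0 := by rw [← h0, hJ]
  have h3 : J (b 3) = -b 2 := by rw [← h2, hJ]
  have h5 : J (b 5) = -b 4 := by rw [← h4, hJ]
  rw [formInner_eq_sum_strictMono b _ _ quadruples mem_quadruples, sum_quadruples]
  simp only [typeProj_three_one_apply J hJ hg, reForm_square_apply, Matrix.cons_val, h0, h1, h2, h3,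
    h4, h5, twoForm_neg_left, twoForm_neg_right, b.inner_eq_ite, map_neg,
    inner_neg_left, inner_neg_right, neg_neg, Fin.isValue,
    Fin.reduceEq, reduceIte, twoForm_swap a (b 0) (b 1), twoForm_swap a (b 2) (b 3),
    twoForm_swap a (b 4) (b 5)]
  generalize a ![b 0, b 1] = a01
  generalize a ![b 0, b 2] = a02
  generalize a ![b 0, b 3] = a03
  generalize a ![b 0, b 4] = a04
  generalize a ![b 0, b 5] = a05
  generalize a ![b 1, b 2] = a12
  generalize a ![b 1, b 3] = a13
  generalize a ![b 1, b 4] = a14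
  generalize a ![b 1, b 5] = a15
  generalize a ![b 2, b 3] = a23
  generalize a ![b 2, b 4] = a24
  generalize a ![b 2, b 5] = a25
  generalize a ![b 3, b 4] = a34
  generalize a ![b 3, b 5] = a35
  generalize a ![b 4, b 5] = a45
  ring

/-- The real part of (ω + i a)³ / 3! is ω³ / 6 - ω ∧ a² / 2, and ω³ / 6 takes the value 1 on the
adapted basis. -/
theorem reForm_cube_apply_basis {b : OrthonormalBasis (Fin 6) ℝ V} (h0 : J (b 0) = b 1)
    (h2 : J (b 2) = b 3) (h4 : J (b 4) = b 5) :
    reForm (((Nat.factorial 3 : ℂ))⁻¹ • wedgeCube (complexifiedForm J hJ hg a)) b =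
      1 - (a ![b 0, b 1] * a ![b 2, b 3] - a ![b 0, b 2] * a ![b 1, b 3]
        + a ![b 0, b 3] * a ![b 1, b 2])
      - (a ![b 0, b 1] * a ![b 4, b 5] - a ![b 0, b 4] * a ![b 1, b 5]
        + a ![b 0, b 5] * a ![b 1, b 4])
      - (a ![b 2, b 3] * a ![b 4, b 5] - a ![b 2, b 4] * a ![b 3, b 5]
        + a ![b 2, b 5] * a ![b 3, b 4]) := by
  have h1 : J (b 1) = -b 0 := by rw [← h0, hJ]
  have h3 : J (b 3) = -b 2 := by rw [← h2, hJ]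
  simp [reForm, wedgeCube_apply, complexifiedForm_apply, fundamentalForm_apply, h0, h1, h2, h3,
    h4, b.inner_eq_ite, Nat.factorial]
  ring

/-- The imaginary part is ω² ∧ a / 2 - a³ / 6: the trace of a against ω minus the full Pfaffian. -/
theorem imForm_cube_apply_basis {b : OrthonormalBasis (Fin 6) ℝ V} (h0 : J (b 0) = b 1)
    (h2 : J (b 2) = b 3) (h4 : J (b 4) = b 5) :
    imForm (((Nat.factorial 3 : ℂ))⁻¹ • wedgeCube (complexifiedForm J hJ hg a)) b =
      a ![b 0, b 1] + a ![b 2, b 3] + a ![b 4, b 5]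
      - (a ![b 0, b 1] * (a ![b 2, b 3] * a ![b 4, b 5] - a ![b 2, b 4] * a ![b 3, b 5]
        + a ![b 2, b 5] * a ![b 3, b 4])
      - a ![b 0, b 2] * (a ![b 1, b 3] * a ![b 4, b 5] - a ![b 1, b 4] * a ![b 3, b 5]
        + a ![b 1, b 5] * a ![b 3, b 4])
      + a ![b 0, b 3] * (a ![b 1, b 2] * a ![b 4, b 5] - a ![b 1, b 4] * a ![b 2, b 5]
        + a ![b 1, b 5] * a ![b 2, b 4])
      - a ![b 0, b 4] * (a ![b 1, b 2] * a ![b 3, b 5] - a ![b 1, b 3] * a ![b 2, b 5]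
        + a ![b 1, b 5] * a ![b 2, b 3])
      + a ![b 0, b 5] * (a ![b 1, b 2] * a ![b 3, b 4] - a ![b 1, b 3] * a ![b 2, b 4]
        + a ![b 1, b 4] * a ![b 2, b 3])) := by
  have h1 : J (b 1) = -b 0 := by rw [← h0, hJ]
  have h3 : J (b 3) = -b 2 := by rw [← h2, hJ]
  simp [imForm, wedgeCube_apply, complexifiedForm_apply, fundamentalForm_apply, h0, h1, h2, h3,
    h4, b.inner_eq_ite, Nat.factorial]
  ring

theorem det_id_add_sharp_eq (b : OrthonormalBasis (Fin 6) ℝ V) (a : V [⋀^Fin 2]→ₗ[ℝ] ℝ) :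
    LinearMap.det (LinearMap.id + sharp a) =
    1 + (a ![b 0, b 1] ^ 2 + a ![b 0, b 2] ^ 2 + a ![b 0, b 3] ^ 2 + a ![b 0, b 4] ^ 2
        + a ![b 0, b 5] ^ 2
        + a ![b 1, b 2] ^ 2 + a ![b 1, b 3] ^ 2 + a ![b 1, b 4] ^ 2 + a ![b 1, b 5] ^ 2
        + a ![b 2, b 3] ^ 2 + a ![b 2, b 4] ^ 2 + a ![b 2, b 5] ^ 2
        + a ![b 3, b 4] ^ 2 + a ![b 3, b 5] ^ 2
        + a ![b 4, b 5] ^ 2)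
      + ((a ![b 0, b 1] * a ![b 2, b 3] - a ![b 0, b 2] * a ![b 1, b 3]
        + a ![b 0, b 3] * a ![b 1, b 2]) ^ 2
        + (a ![b 0, b 1] * a ![b 2, b 4] - a ![b 0, b 2] * a ![b 1, b 4]
        + a ![b 0, b 4] * a ![b 1, b 2]) ^ 2
        + (a ![b 0, b 1] * a ![b 2, b 5] - a ![b 0, b 2] * a ![b 1, b 5]
        + a ![b 0, b 5] * a ![b 1, b 2]) ^ 2
        + (a ![b 0, b 1] * a ![b 3, b 4] - a ![b 0, b 3] * a ![b 1, b 4]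
        + a ![b 0, b 4] * a ![b 1, b 3]) ^ 2
        + (a ![b 0, b 1] * a ![b 3, b 5] - a ![b 0, b 3] * a ![b 1, b 5]
        + a ![b 0, b 5] * a ![b 1, b 3]) ^ 2
        + (a ![b 0, b 1] * a ![b 4, b 5] - a ![b 0, b 4] * a ![b 1, b 5]
        + a ![b 0, b 5] * a ![b 1, b 4]) ^ 2
        + (a ![b 0, b 2] * a ![b 3, b 4] - a ![b 0, b 3] * a ![b 2, b 4]
        + a ![b 0, b 4] * a ![b 2, b 3]) ^ 2
        + (a ![b 0, b 2] * a ![b 3, b 5] - a ![b 0, b 3] * a ![b 2, b 5]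
        + a ![b 0, b 5] * a ![b 2, b 3]) ^ 2
        + (a ![b 0, b 2] * a ![b 4, b 5] - a ![b 0, b 4] * a ![b 2, b 5]
        + a ![b 0, b 5] * a ![b 2, b 4]) ^ 2
        + (a ![b 0, b 3] * a ![b 4, b 5] - a ![b 0, b 4] * a ![b 3, b 5]
        + a ![b 0, b 5] * a ![b 3, b 4]) ^ 2
        + (a ![b 1, b 2] * a ![b 3, b 4] - a ![b 1, b 3] * a ![b 2, b 4]
        + a ![b 1, b 4] * a ![b 2, b 3]) ^ 2
        + (a ![b 1, b 2] * a ![b 3, b 5] - a ![b 1, b 3] * a ![b 2, b 5]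
        + a ![b 1, b 5] * a ![b 2, b 3]) ^ 2
        + (a ![b 1, b 2] * a ![b 4, b 5] - a ![b 1, b 4] * a ![b 2, b 5]
        + a ![b 1, b 5] * a ![b 2, b 4]) ^ 2
        + (a ![b 1, b 3] * a ![b 4, b 5] - a ![b 1, b 4] * a ![b 3, b 5]
        + a ![b 1, b 5] * a ![b 3, b 4]) ^ 2
        + (a ![b 2, b 3] * a ![b 4, b 5] - a ![b 2, b 4] * a ![b 3, b 5]
        + a ![b 2, b 5] * a ![b 3, b 4]) ^ 2)
      + (a ![b 0, b 1] * (a ![b 2, b 3] * a ![b 4, b 5] - a ![b 2, b 4] * a ![b 3, b 5]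
        + a ![b 2, b 5] * a ![b 3, b 4])
      - a ![b 0, b 2] * (a ![b 1, b 3] * a ![b 4, b 5] - a ![b 1, b 4] * a ![b 3, b 5]
        + a ![b 1, b 5] * a ![b 3, b 4])
      + a ![b 0, b 3] * (a ![b 1, b 2] * a ![b 4, b 5] - a ![b 1, b 4] * a ![b 2, b 5]
        + a ![b 1, b 5] * a ![b 2, b 4])
      - a ![b 0, b 4] * (a ![b 1, b 2] * a ![b 3, b 5] - a ![b 1, b 3] * a ![b 2, b 5]
        + a ![b 1, b 5] * a ![b 2, b 3])
      + a ![b 0, b 5] * (a ![b 1, b 2] * a ![b 3, b 4] - a ![b 1, b 3] * a ![b 2, b 4]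
        + a ![b 1, b 4] * a ![b 2, b 3])) ^ 2 := by
  have hsw (u v : V) : a ![v, u] = -a ![u, v] := twoForm_swap a u v
  have hs (u : V) : a ![u, u] = 0 := a.map_eq_zero_of_eq ![u, u] (i := 0) (j := 1) rfl (by simp)
  have hM : (1 + Matrix.of fun i j => a ![b i, b j]) =
      !![1, a ![b 0, b 1], a ![b 0, b 2], a ![b 0, b 3], a ![b 0, b 4], a ![b 0, b 5];
        -a ![b 0, b 1], 1, a ![b 1, b 2], a ![b 1, b 3], a ![b 1, b 4], a ![b 1, b 5];
        -a ![b 0, b 2], -a ![b 1, b 2], 1, a ![b 2, b 3], a ![b 2, b 4], a ![b 2, b 5];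
        -a ![b 0, b 3], -a ![b 1, b 3], -a ![b 2, b 3], 1, a ![b 3, b 4], a ![b 3, b 5];
        -a ![b 0, b 4], -a ![b 1, b 4], -a ![b 2, b 4], -a ![b 3, b 4], 1, a ![b 4, b 5];
        -a ![b 0, b 5], -a ![b 1, b 5], -a ![b 2, b 5], -a ![b 3, b 5], -a ![b 4, b 5], 1] := by
    ext i j
    fin_cases i <;> fin_cases j <;> simp [hs] <;> exact hsw _ _
  rw [det_id_add_sharp b, hM, det_one_add_skew]

-- The identity can be compared by degree in a. Write T for the trace a₀₁ + a₂₃ + a₄₅, P for the sum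
-- of the Pfaffians on two J-pairs, and Pf for the full one. Degree 2 says that T² - 2 P plus the
-- six squares from ω ∧ a is |a|². Degree 4 says that P² - 2 T Pf plus the six squares from a² / 2
-- is the sum of all squared 4 × 4 Pfaffians. Degrees 0 and 6 are 1 and Pf².
variable (J hJ hg a) in
theorem formNorm_cube_sq_add_formNorm_square_sq (hV : finrank ℝ V = 6) :
    formNorm (((Nat.factorial 3 : ℂ))⁻¹ • wedgeCube (complexifiedForm J hJ hg a)) ^ 2
      + 2 * formNorm (typeProjC J 3 1
        (((Nat.factorial 2 : ℂ))⁻¹ • wedgeSq (complexifiedForm J hJ hg a))) ^ 2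
      = LinearMap.det (LinearMap.id + sharp a) := by
  obtain ⟨b, h0, h2, h4⟩ := exists_adapted_basis hV J hJ hg
  rw [formNorm_sq_complex, formNorm_sq_complex, formNorm_sq_real, formNorm_sq_real,
    formNorm_sq_real, formNorm_sq_real, formInner_top b, formInner_top b,
    reForm_cube_apply_basis h0 h2 h4, imForm_cube_apply_basis h0 h2 h4,
    reForm_typeProjC, imForm_typeProjC, formInner_typeProj_imForm_square h0 h2 h4,
    formInner_typeProj_reForm_square h0 h2 h4, det_id_add_sharp_eq b]
  generalize a ![b 0, b 1] = a01
  generalize a ![b 0, b 2] = a02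
  generalize a ![b 0, b 3] = a03
  generalize a ![b 0, b 4] = a04
  generalize a ![b 0, b 5] = a05
  generalize a ![b 1, b 2] = a12
  generalize a ![b 1, b 3] = a13
  generalize a ![b 1, b 4] = a14
  generalize a ![b 1, b 5] = a15
  generalize a ![b 2, b 3] = a23
  generalize a ![b 2, b 4] = a24
  generalize a ![b 2, b 5] = a25
  generalize a ![b 3, b 4] = a34
  generalize a ![b 3, b 5] = a35
  generalize a ![b 4, b 5] = a45
  ring

end DimensionThree

/-! ### The inequality and its equality case at a point -/

section CalibrationInequality

variable {V : Type*} [NormedAddCommGroup V] [InnerProductSpace ℝ V] {k : ℕ}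

theorem eq_zero_iff_reForm_imForm {α : V [⋀^Fin k]→ₗ[ℝ] ℂ} :
    α = 0 ↔ reForm α = 0 ∧ imForm α = 0 := by
  refine ⟨fun h => ⟨?_, ?_⟩, fun ⟨h1, h2⟩ => ?_⟩
  · ext v
    simp [h, reForm]
  · ext v
    simp [h, imForm]
  · ext v
    exact Complex.ext (congrArg (fun f => f v) h1) (congrArg (fun f => f v) h2)

/-- Bridges the normalised cube in the inequality and the unnormalised one in the dHYM equation. -/
theorem imForm_smul_inv_factorial_eq_zero (c : ℂ) (n : ℕ) (α : V [⋀^Fin k]→ₗ[ℝ] ℂ) :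
    imForm (c • ((Nat.factorial n : ℂ))⁻¹ • α) = 0 ↔ imForm (c • α) = 0 := by
  have hn : ((Nat.factorial n : ℝ))⁻¹ ≠ 0 := inv_ne_zero (Nat.cast_ne_zero.2 n.factorial_ne_zero)
  have e : imForm (c • ((Nat.factorial n : ℂ))⁻¹ • α) =
      ((Nat.factorial n : ℝ))⁻¹ • imForm (c • α) := by
    ext v
    have h1 : c * (((Nat.factorial n : ℂ))⁻¹ * α v) =
        (((Nat.factorial n : ℝ))⁻¹ : ℝ) * (c * α v) := by
      push_cast
      ring
    change (c * (((Nat.factorial n : ℂ))⁻¹ * α v)).im = ((Nat.factorial n : ℝ))⁻¹ * (c * α v).im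
    rw [h1, Complex.im_ofReal_mul]
  rw [e, smul_eq_zero, or_iff_right hn]

/-- The six equations relate the coefficients across different J-pairs; a coefficient within a
J-pair is invariant by antisymmetry. -/
theorem apply_complexStructure_eq_of_basis {J : V →ₗ[ℝ] V} {a : V [⋀^Fin 2]→ₗ[ℝ] ℝ} {b : Fin 6 → V}
    (h0 : J (b 0) = b 1)
    (h1 : J (b 1) = -b 0) (h2 : J (b 2) = b 3) (h3 : J (b 3) = -b 2) (h4 : J (b 4) = b 5)
    (h5 : J (b 5) = -b 4) (e1 : a ![b 0, b 2] = a ![b 1, b 3]) (e2 : a ![b 0, b 3] = -a ![b 1, b 2])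
    (e3 : a ![b 0, b 4] = a ![b 1, b 5]) (e4 : a ![b 0, b 5] = -a ![b 1, b 4])
    (e5 : a ![b 2, b 4] = a ![b 3, b 5]) (e6 : a ![b 2, b 5] = -a ![b 3, b 4]) (i j : Fin 6) :
    a ![J (b i), J (b j)] = a ![b i, b j] := by
  have hlt (i j : Fin 6) (hij : i < j) : a ![J (b i), J (b j)] = a ![b i, b j] := by
    fin_cases i <;> fin_cases j <;> first
      | exact absurd hij (by decide)
      | simp only [Fin.zero_eta, Fin.mk_one, Fin.reduceFinMk, h0, h1, h2, h3, h4, h5,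
          twoForm_neg_left, twoForm_neg_right, twoForm_swap a (b 0) (b 1),
          twoForm_swap a (b 2) (b 3), twoForm_swap a (b 4) (b 5), e1, e2, e3, e4, e5, e6, neg_neg]
  rcases lt_trichotomy i j with hij | rfl | hij
  · exact hlt i j hij
  · rw [a.map_eq_zero_of_eq ![b i, b i] (i := 0) (j := 1) rfl (by simp),
      a.map_eq_zero_of_eq ![J (b i), J (b i)] (i := 0) (j := 1) rfl (by simp)]
  · rw [twoForm_swap a (J (b j)), twoForm_swap a (b j), hlt j i hij]

variable [FiniteDimensional ℝ V]

theorem formNorm_nonneg {W : Type*} [NormedAddCommGroup W] [NormedSpace ℝ W]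
    (α : V [⋀^Fin k]→ₗ[ℝ] W) : 0 ≤ formNorm α :=
  Real.sqrt_nonneg _

theorem formInner_self_eq_zero {α : V [⋀^Fin k]→ₗ[ℝ] ℝ} : formInner α α = 0 ↔ α = 0 :=
  ⟨(formCore V k).definite α, fun h => by simp [h, formInner]⟩

theorem formNorm_real_eq_zero {α : V [⋀^Fin k]→ₗ[ℝ] ℝ} : formNorm α = 0 ↔ α = 0 := by
  rw [← formInner_self_eq_zero, ← formNorm_sq_real, sq_eq_zero_iff]

theorem formNorm_complex_eq_zero {α : V [⋀^Fin k]→ₗ[ℝ] ℂ} : formNorm α = 0 ↔ α = 0 := by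
  rw [eq_zero_iff_reForm_imForm, ← formNorm_real_eq_zero, ← formNorm_real_eq_zero,
    ← sq_eq_zero_iff, formNorm_sq_complex,
    add_eq_zero_iff_of_nonneg (sq_nonneg _) (sq_nonneg _), sq_eq_zero_iff, sq_eq_zero_iff]

theorem formNorm_smul_of_norm_eq_one {c : ℂ} (hc : ‖c‖ = 1) (α : V [⋀^Fin k]→ₗ[ℝ] ℂ) :
    formNorm (c • α) = formNorm α := by
  simp [formNorm, hc]

variable {J : V →ₗ[ℝ] V} {hJ : ∀ v, J (J v) = -v}
  {hg : ∀ u v, inner ℝ (J u) (J v) = inner ℝ u v} {a : V [⋀^Fin 2]→ₗ[ℝ] ℝ}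

/-- The hypothesis says J^* a = a. Then ω + i a and its square are J-invariant, so (1 - J^*) / 2
kills the square. -/
theorem typeProjC_square_eq_zero_of_typeProj (h : typeProj J 2 0 a = 0) :
    typeProjC J 3 1 (((Nat.factorial 2 : ℂ))⁻¹ • wedgeSq (complexifiedForm J hJ hg a)) = 0 := by
  have ha (v : Fin 2 → V) : a (fun i => J (v i)) = a v := by
    have h1 := typeProj_two_zero_apply J hJ hg a v
    rw [h, AlternatingMap.zero_apply] at h1
    linarith
  have hω (v : Fin 2 → V) : fundamentalForm J hJ hg (fun i => J (v i)) =
      fundamentalForm J hJ hg v := hg (J (v 0)) (v 1)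
  have hc : (complexifiedForm J hJ hg a).compLinearMap J = complexifiedForm J hJ hg a := by
    ext v
    rw [AlternatingMap.compLinearMap_apply, complexifiedForm_apply, complexifiedForm_apply]
    rw [ha, hω]
  have hsq (v : Fin 4 → V) : wedgeSq (complexifiedForm J hJ hg a) (fun i => J (v i)) =
      wedgeSq (complexifiedForm J hJ hg a) v := by
    have h1 := wedge_compLinearMap (complexifiedForm J hJ hg a) (complexifiedForm J hJ hg a) J
    rw [hc] at h1
    exact congrArg (fun f => f v) h1
  refine eq_zero_iff_reForm_imForm.2 ⟨?_, ?_⟩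
  · rw [reForm_typeProjC]
    ext v
    rw [typeProj_three_one_apply J hJ hg]
    simp only [reForm, LinearMap.compAlternatingMap_apply, AlternatingMap.smul_apply, hsq, sub_self,
      mul_zero, AlternatingMap.zero_apply]
  · rw [imForm_typeProjC]
    ext v
    rw [typeProj_three_one_apply J hJ hg]
    simp only [imForm, LinearMap.compAlternatingMap_apply, AlternatingMap.smul_apply, hsq, sub_self,
      mul_zero, AlternatingMap.zero_apply]

/-- The imaginary part ω ∧ a already suffices: its projection has a sum of six squares as norm, so
all six vanish and a is J-invariant. -/
theorem typeProj_eq_zero_of_typeProjC_square (hV : finrank ℝ V = 6)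
    (h : typeProjC J 3 1
      (((Nat.factorial 2 : ℂ))⁻¹ • wedgeSq (complexifiedForm J hJ hg a)) = 0) :
    typeProj J 2 0 a = 0 := by
  obtain ⟨b, h0, h2, h4⟩ := exists_adapted_basis hV J hJ hg
  have h1 : J (b 1) = -b 0 := by rw [← h0, hJ]
  have h3 : J (b 3) = -b 2 := by rw [← h2, hJ]
  have h5 : J (b 5) = -b 4 := by rw [← h4, hJ]
  have him := (eq_zero_iff_reForm_imForm.1 h).2
  rw [imForm_typeProjC, ← formInner_self_eq_zero, formInner_typeProj_imForm_square h0 h2 h4] at him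
  have hadd (x y : ℝ) (hx : 0 ≤ x) : x + y ^ 2 = 0 ↔ x = 0 ∧ y = 0 := by
    rw [add_eq_zero_iff_of_nonneg hx (sq_nonneg y), sq_eq_zero_iff]
  rw [mul_eq_zero, or_iff_right (by norm_num), hadd _ _ (by positivity), hadd _ _ (by positivity),
    hadd _ _ (by positivity), hadd _ _ (by positivity), hadd _ _ (by positivity),
    sq_eq_zero_iff] at him
  simp only [and_assoc, sub_eq_zero, add_eq_zero_iff_eq_neg] at him
  obtain ⟨e1, e2, e3, e4, e5, e6⟩ := him
  have key := apply_complexStructure_eq_of_basis h0 h1 h2 h3 h4 h5 e1 e2 e3 e4 e5 e6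
  refine Basis.ext_alternating b.toBasis fun v _ => ?_
  rw [typeProj_two_zero_apply J hJ hg]
  have e (w : Fin 2 → V) : a w = a ![w 0, w 1] := congrArg a (List.ofFn_inj.1 rfl)
  rw [e, e fun i => J _]
  simp only [OrthonormalBasis.coe_toBasis, key, sub_self, mul_zero, AlternatingMap.zero_apply]

/-- Multiplication by a unit phase preserves the norm of the cube, which then splits into real and
imaginary parts. -/
theorem formNorm_reForm_smul_cube (hV : finrank ℝ V = 6) {c : ℂ} (hc : ‖c‖ = 1) :
    formNorm (reForm
        (c • ((Nat.factorial 3 : ℂ))⁻¹ • wedgeCube (complexifiedForm J hJ hg a))) ^ 2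
      + formNorm (imForm
        (c • ((Nat.factorial 3 : ℂ))⁻¹ • wedgeCube (complexifiedForm J hJ hg a))) ^ 2
      + 2 * formNorm (typeProjC J 3 1
        (((Nat.factorial 2 : ℂ))⁻¹ • wedgeSq (complexifiedForm J hJ hg a))) ^ 2
      = LinearMap.det (LinearMap.id + sharp a) := by
  rw [← formNorm_sq_complex, formNorm_smul_of_norm_eq_one hc,
    formNorm_cube_sq_add_formNorm_square_sq J hJ hg a hV]

theorem formNorm_reForm_smul_cube_le (hV : finrank ℝ V = 6) {c : ℂ} (hc : ‖c‖ = 1) :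
    formNorm (reForm
        (c • ((Nat.factorial 3 : ℂ))⁻¹ • wedgeCube (complexifiedForm J hJ hg a)))
      ≤ √(LinearMap.det (LinearMap.id + sharp a)) := by
  refine Real.le_sqrt_of_sq_le ?_
  rw [← formNorm_reForm_smul_cube (hJ := hJ) (hg := hg) hV hc, add_assoc]
  exact le_add_of_nonneg_right (by positivity)

theorem formNorm_reForm_smul_cube_eq_iff (hV : finrank ℝ V = 6) {c : ℂ} (hc : ‖c‖ = 1) :
    formNorm (reForm
        (c • ((Nat.factorial 3 : ℂ))⁻¹ • wedgeCube (complexifiedForm J hJ hg a)))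
      = √(LinearMap.det (LinearMap.id + sharp a)) ↔
    typeProj J 2 0 a = 0 ∧ imForm (c • wedgeCube (complexifiedForm J hJ hg a)) = 0 := by
  have key := formNorm_reForm_smul_cube (hJ := hJ) (hg := hg) (a := a) hV hc
  -- Squaring the equation requires a nonnegative determinant; `key` exhibits it as a sum of
  -- squares.
  rw [← imForm_smul_inv_factorial_eq_zero c 3, eq_comm,
    Real.sqrt_eq_iff_eq_sq (by rw [← key]; positivity) (formNorm_nonneg _), ← key]
  constructor
  · intro h
    have h1 : formNorm (imForm
        (c • ((Nat.factorial 3 : ℂ))⁻¹ • wedgeCube (complexifiedForm J hJ hg a))) = 0 := by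
      rw [← sq_eq_zero_iff]
      nlinarith [sq_nonneg (formNorm (typeProjC J 3 1
        (((Nat.factorial 2 : ℂ))⁻¹ • wedgeSq (complexifiedForm J hJ hg a)))),
        sq_nonneg (formNorm (imForm
        (c • ((Nat.factorial 3 : ℂ))⁻¹ • wedgeCube (complexifiedForm J hJ hg a))))]
    have h2 : formNorm (typeProjC J 3 1
        (((Nat.factorial 2 : ℂ))⁻¹ • wedgeSq (complexifiedForm J hJ hg a))) = 0 := by
      rw [h1] at h
      rw [← sq_eq_zero_iff]
      linarith
    exact ⟨typeProj_eq_zero_of_typeProjC_square hV (formNorm_complex_eq_zero.1 h2),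
      formNorm_real_eq_zero.1 h1⟩
  · rintro ⟨h1, h2⟩
    rw [formNorm_real_eq_zero.2 h2,
      formNorm_complex_eq_zero.2 (typeProjC_square_eq_zero_of_typeProj h1)]
    ring

end CalibrationInequality

/-! ### Passage from the line bundle to the pointwise model -/

section KaehlerLineBundle

variable {E : Type*} [NormedAddCommGroup E] [NormedSpace ℂ E]
  {X : Type*} [TopologicalSpace X] [ChartedSpace E X]

theorem finrank_tangentSpace (x : X) :
    finrank ℝ (TangentSpace 𝓘(ℝ, E) x) = 2 * finrank ℂ E :=
  finrank_real_of_complex E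

variable [FiniteDimensional ℂ E] [IsManifold 𝓘(ℂ, E) ω X]
  [RiemannianBundle (fun x : X => TangentSpace 𝓘(ℝ, E) x)] (hX : IsKaehler E X)
  {L : X → Type*} [TopologicalSpace (TotalSpace ℂ L)]
  [∀ x, AddCommGroup (L x)] [∀ x, Module ℂ (L x)] [∀ x, TopologicalSpace (L x)]
  [∀ x, IsTopologicalAddGroup (L x)] [∀ x, ContinuousSMul ℝ (L x)]
  [FiberBundle ℂ L] [VectorBundle ℂ ℂ L] [VectorBundle ℝ ℂ L]
  [ContMDiffVectorBundle ∞ ℂ L 𝓘(ℝ, E)]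
  {h : HermitianMetric E L} (D : HermitianConnection h)

/-- `realCurvature` keeps only the real part of -i F. Since F is imaginary nothing is lost, and F =
i (-i F). -/
theorem kaehlerAddCurvature_eq_complexifiedForm (x : X) :
    kaehlerAddCurvature hX D x = complexifiedForm (complexStructure x) (complexStructure_sq x)
      (hX.hermitian x) (realCurvature D x) := by
  ext v
  have e (α : TangentSpace 𝓘(ℝ, E) x [⋀^Fin 2]→ₗ[ℝ] ℂ) : α v = α ![v 0, v 1] :=
    congrArg α (List.ofFn_inj.1 rfl)
  have h1 := D.conj_curvature x (v 0) (v 1)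
  rw [← e] at h1
  have h2 : (D.curvature x v).re = 0 := by
    have := congrArg Complex.re h1
    simp only [Complex.conj_re, Complex.neg_re] at this
    linarith
  rw [complexifiedForm_apply]
  change (hX.form x v : ℂ) + D.curvature x v =
    (hX.form x v : ℂ) + Complex.I * ((-Complex.I * D.curvature x v).re : ℂ)
  congr 1
  apply Complex.ext <;> simp [h2]

end KaehlerLineBundle

end MirrorSL

end

theorem theorem6p1
    {E : Type*} [NormedAddCommGroup E] [NormedSpace ℂ E] [FiniteDimensional ℂ E]
    (hE : Module.finrank ℂ E = 3)
    {X : Type*} [TopologicalSpace X] [ChartedSpace E X] [IsManifold 𝓘(ℂ, E) ω X]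
    [RiemannianBundle (fun x : X => TangentSpace 𝓘(ℝ, E) x)]
    [IsContMDiffRiemannianBundle 𝓘(ℝ, E) ∞ E (fun x : X => TangentSpace 𝓘(ℝ, E) x)]
    (hX : MirrorSL.IsKaehler E X)
    {L : X → Type*} [TopologicalSpace (TotalSpace ℂ L)]
    [∀ x, AddCommGroup (L x)] [∀ x, Module ℂ (L x)] [∀ x, TopologicalSpace (L x)]
    [∀ x, IsTopologicalAddGroup (L x)] [∀ x, ContinuousSMul ℝ (L x)]
    [FiberBundle ℂ L] [VectorBundle ℂ ℂ L] [VectorBundle ℝ ℂ L]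
    [ContMDiffVectorBundle ∞ ℂ L 𝓘(ℝ, E)]
    (h : MirrorSL.HermitianMetric E L) (D : MirrorSL.HermitianConnection h) :
    (∀ x : X,
      MirrorSL.formNorm (MirrorSL.cubeForm hX D x) ^ 2
        + 2 * MirrorSL.formNorm (MirrorSL.typeProjC (MirrorSL.complexStructure x) 3 1
            (MirrorSL.squareForm hX D x)) ^ 2
      = MirrorSL.detCurvature D x) ∧
    ∀ θ : ℝ,
      (∀ x : X,
        MirrorSL.formNorm (MirrorSL.reForm
            (Complex.exp (-(Complex.I * θ)) • MirrorSL.cubeForm hX D x))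
          ≤ √(MirrorSL.detCurvature D x)) ∧
      ((∀ x : X,
        MirrorSL.formNorm (MirrorSL.reForm
            (Complex.exp (-(Complex.I * θ)) • MirrorSL.cubeForm hX D x))
          = √(MirrorSL.detCurvature D x)) ↔ MirrorSL.IsDHYM hX D θ) := by
  have hV (x : X) : Module.finrank ℝ (TangentSpace 𝓘(ℝ, E) x) = 6 := by
    rw [MirrorSL.finrank_tangentSpace, hE]
  have hc (θ : ℝ) : ‖Complex.exp (-(Complex.I * θ))‖ = 1 := by
    simp [Complex.norm_exp]
  refine ⟨fun x => ?_, fun θ => ⟨fun x => ?_, forall_congr' fun x => ?_⟩⟩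
  · rw [MirrorSL.detCurvature, MirrorSL.cubeForm, MirrorSL.squareForm,
      MirrorSL.kaehlerAddCurvature_eq_complexifiedForm]
    convert MirrorSL.formNorm_cube_sq_add_formNorm_square_sq (MirrorSL.complexStructure x)
      (MirrorSL.complexStructure_sq x) (hX.hermitian x) (MirrorSL.realCurvature D x) (hV x)
  · rw [MirrorSL.detCurvature, MirrorSL.cubeForm, MirrorSL.kaehlerAddCurvature_eq_complexifiedForm]
    convert MirrorSL.formNorm_reForm_smul_cube_le (hV x) (hc θ)
  · rw [MirrorSL.detCurvature, MirrorSL.cubeForm, MirrorSL.kaehlerAddCurvature_eq_complexifiedForm]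
    convert MirrorSL.formNorm_reForm_smul_cube_eq_iff (hV x) (hc θ)
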